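/- **Setting.** Let $Q$ be a plane quadrangulation, that is, a connected simple bipartite plane graph all of whose faces (including the outer face) have degree four, with colour classes of black and white vertices; let $n$ be its number of vertices and let $s_0\neq s_1$ be the two black vertices on the outer face. A *strong labeling* of $Q$ is a map from the angles of $Q$ to $\{0,1\}$ such that * all angles at $s_i$ have label $i$ ($i=0,1$); * at each vertex $v\notin\{s_0,s_1\}$ the labels form, cyclically, a non-empty interval of $0$s and a non-empty interval of $1$s; * for each edge, the two incident labels coincide at one endpoint and differ at the other; * the labels in each face are $0011$ cyclically, and those of the outer face, read in clockwise order starting at $s_0$, are $0011$. Fix a strong labeling. Orient each edge towards its endpoint with two coincident labels and colour it with that label; let $T_i$ be the set of oriented edges of colour $i$. For $v\notin\{s_0,s_1\}$ let $P_i(v)$ be the directed path in $T_i$ from $v$ to $s_i$. The paths $P_0(v)$ and $P_1(v)$ split the part of the plane enclosed by the outer boundary into two (possibly degenerate) regions; let $R_i(v)$ be the one to the right of $P_i(v)$, and $f_i(v)$ the number of bounded faces in $R_i(v)$. Put $f_0(s_0)=f_1(s_1)=-1$ and $f_1(s_0)=f_0(s_1)=n-2$. **Theorem.** For every strong labeling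 of a plane quadrangulation $Q$ with $n$ vertices the following hold. 1. All points $(f_0(v),f_1(v))$ lie on the line $f_0+f_1=n-3$, and each $f_i$ is a bijection from the vertices onto $\{-1,0,\dots,n-2\}$. Thus the vertices are placed at distinct, equally spaced points of a line, on which $f_1$ increases from left to right. 2. For $i\in\{0,1\}$, $T_i$ is a tree that spans all vertices except $s_{1-i}$. 3. If each $T_i$ is drawn on its own side of the line, then $T_0$ and $T_1$ are non-crossing: no $T_i$ has edges $ac$ and $bd$ with $a,b,c,d$ in this order on the line. 4. $T_0$ and $T_1$ are alternating: no $T_i$ has edges $ab$ and $bc$ with $a,b,c$ in this order on the line. Consequently this is a 2-book embedding of $Q$ (every edge of $Q$ is on exactly one of the two pages, and edges on the same page do not cross) with a non-crossing alternating tree on each page. -/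

import Mathlib

/-- A rotation system: a cyclic order of the edges at each vertex.  A dart `d` is an edge together
with a direction, from its tail `d.fst` to its head `d.snd`.  The permutation `rot` sends a dart to the next dart with
the same tail in *counterclockwise* order. -/
structure RotationSystem {V : Type*} (G : SimpleGraph V) where
  rot : Equiv.Perm G.Dart
  rot_fst : ∀ d, (rot d).fst = d.fst
  rot_cyclic : ∀ d e : G.Dart, d.fst = e.fst → rot.SameCycle d e

namespace RotationSystem

variable {V : Type*} {G : SimpleGraph V} (R : RotationSystem G)

/-- From a dart `d`, go on to the next dart along the boundary of the face on the *right* of `d`,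
keeping that face on the right (at the head of `d`, this is the dart which follows the reversal
of `d` counterclockwise). -/
def next : Equiv.Perm G.Dart :=
  (Function.Involutive.toPerm SimpleGraph.Dart.symm SimpleGraph.Dart.symm_involutive).trans R.rot

/-- The faces are the orbits of `next`. -/
def Face : Type _ := Quotient (Equiv.Perm.SameCycle.setoid R.next)

/-- The face on the right of a dart. -/
def right (d : G.Dart) : R.Face := Quotient.mk _ d

/-- The face on the left of a dart. -/
def left (d : G.Dart) : R.Face := R.right d.symm

end RotationSystem

/-- A plane graph, given combinatorially: a connected simple graph with a rotation system of genus
zero (this is Euler's relation) and a distinguished outer face. -/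
structure PlaneGraph (V : Type*) where
  graph : SimpleGraph V
  connected : graph.Connected
  emb : RotationSystem graph
  euler : Nat.card V + Nat.card emb.Face = Nat.card graph.edgeSet + 2
  outer : emb.Face

/-- A plane quadrangulation with its colour classes of black and white vertices: every face
(including the outer one) has degree four.  The two black vertices on the outer face are named
`s 0` and `s 1`. -/
structure Quadrangulation (V : Type*) extends PlaneGraph V where
  face_degree : ∀ F : emb.Face, {d | emb.right d = F}.ncard = 4
  black : Set V
  bipartite : graph.IsBipartiteWith black blackᶜ
  s : Fin 2 → V
  s_ne : s 0 ≠ s 1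
  s_black : ∀ i, s i ∈ black
  s_outer : ∀ i, ∃ d, d.fst = s i ∧ emb.right d = outer

namespace Quadrangulation

variable {V : Type*} (Q : Quadrangulation V)

/-- Strong labelings.  Angles correspond to darts: the angle of `d` is the one at the tail of `d`,
in the face on the right of `d`, that is, between `rot⁻¹ d` and `d`.  So `lab d` and
`lab (rot d)` are the labels at the tail of `d` on the right and on the left of `d`, and the
labels of a face, in their cyclic order, are those of the darts of an orbit of `next`. -/
structure IsStrongLabeling (lab : Q.graph.Dart → Fin 2) : Prop where
  /-- All angles at `s i` have label `i`. -/
  special : ∀ i d, d.fst = Q.s i → lab d = i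
  /-- At every other vertex the labels are, in cyclic order, a non-empty interval of `0`s followed
  by a non-empty interval of `1`s. -/
  vertex_rule : ∀ v, (∀ i, v ≠ Q.s i) →
    ∃ d : Q.graph.Dart, d.fst = v ∧ ∃ k, 0 < k ∧ k < (Q.graph.neighborSet v).ncard ∧
      ∀ j < (Q.graph.neighborSet v).ncard, lab ((Q.emb.rot ^ j) d) = 0 ↔ j < k
  /-- For each edge, the labels coincide at one endpoint and differ at the other. -/
  edge_rule : ∀ d : Q.graph.Dart,
    Xor (lab d = lab (Q.emb.rot d)) (lab d.symm = lab (Q.emb.rot d.symm))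
  /-- The labels in each face are `0011` cyclically. -/
  face_rule : ∀ F : Q.emb.Face, ∃ d, Q.emb.right d = F ∧ lab d = 0 ∧ lab (Q.emb.next d) = 0 ∧
    lab ((Q.emb.next ^ 2) d) = 1 ∧ lab ((Q.emb.next ^ 3) d) = 1
  /-- Read in clockwise order starting at `s 0`, the labels of the outer face are `0011`.
  (The permutation `next` keeps the outer face on the right, hence the rest of the drawing on the
  left, and runs around the drawing counterclockwise; clockwise is its inverse.) -/
  outer_rule : ∀ d, Q.emb.right d = Q.outer → d.fst = Q.s 0 →
    lab d = 0 ∧ lab (Q.emb.next⁻¹ d) = 0 ∧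
    lab ((Q.emb.next⁻¹ ^ 2) d) = 1 ∧ lab ((Q.emb.next⁻¹ ^ 3) d) = 1

variable (lab : Q.graph.Dart → Fin 2)

/-- The oriented edges of colour `i`: an edge is directed towards its endpoint with two coincident
labels, and has that label as its colour. -/
def T (i : Fin 2) : Set Q.graph.Dart :=
  {d | lab d ≠ lab (Q.emb.rot d) ∧ lab d.symm = i ∧ lab (Q.emb.rot d.symm) = i}

/-- The edges of colour `i` without their orientation. -/
def tree (i : Fin 2) : SimpleGraph V :=
  SimpleGraph.fromEdgeSet (SimpleGraph.Dart.edge '' Q.T lab i)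

/-- There is a directed walk in `T i` from `u` to `v`. -/
def Reaches (i : Fin 2) : V → V → Prop :=
  Relation.ReflTransGen fun u v => ∃ d ∈ Q.T lab i, d.fst = u ∧ d.snd = v

/-- The oriented edges of `P i v`, the directed path in `T i` from `v` to `s i`. -/
def P (i : Fin 2) (v : V) : Set Q.graph.Dart :=
  {d ∈ Q.T lab i | Q.Reaches lab i v d.fst ∧ Q.Reaches lab i d.snd (Q.s i)}

/-- `A` and `B` are bounded faces that share an edge which lies on neither of the paths
`P 0 v` and `P 1 v`. -/
def AdjOff (v : V) (A B : Q.emb.Face) : Prop :=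
  A ≠ Q.outer ∧ B ≠ Q.outer ∧ ∃ d : Q.graph.Dart, Q.emb.right d = A ∧ Q.emb.left d = B ∧
    ∀ i, d ∉ Q.P lab i v ∧ d.symm ∉ Q.P lab i v

/-- The (bounded) faces in the region `R i v`, which lies to the right of `P i v` and hence to
the left of `P (1 - i) v` (the two paths together form one path from `s (1 - i)` to `s i`, on
which `P (1 - i) v` is traversed backwards): the faces that can be reached from a bounded face immediately to that side of the two paths
without crossing the paths or leaving the outer cycle. -/
def R (i : Fin 2) (v : V) : Set Q.emb.Face :=
  {F | ∃ A, A ≠ Q.outer ∧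
    ((∃ d ∈ Q.P lab i v, Q.emb.right d = A) ∨ ∃ d ∈ Q.P lab (1 - i) v, Q.emb.left d = A) ∧
    Relation.ReflTransGen (Q.AdjOff lab v) A F}

open Classical in
/-- The face-counting coordinates. -/
noncomputable def f (i : Fin 2) (v : V) : ℤ :=
  if v = Q.s i then -1
  else if v = Q.s (1 - i) then (Nat.card V : ℤ) - 2
  else ((Q.R lab i v).ncard : ℤ)

end Quadrangulation

/-- With the vertices at the positions `x` on a line, the edges of `H`, drawn on one side of the
line, are pairwise non-crossing. -/
def NonCrossing {V : Type*} (H : SimpleGraph V) (x : V → ℤ) : Prop :=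
  ∀ a b c d, x a < x b → x b < x c → x c < x d → ¬ (H.Adj a c ∧ H.Adj b d)

/-- With the vertices at the positions `x` on a line, `H` has no two edges `ab` and `bc` with `b`
strictly between `a` and `c`. -/
def Alternating {V : Type*} (H : SimpleGraph V) (x : V → ℤ) : Prop :=
  ∀ a b c, x a < x b → x b < x c → ¬ (H.Adj a b ∧ H.Adj b c)

/-- A 2-book embedding of `G`: the vertices are at distinct points `x` of the spine, each edge is
on exactly one of the two pages, and no two edges of the same page cross. -/
structure IsTwoBookEmbedding {V : Type*} (G : SimpleGraph V) (x : V → ℤ)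
    (page : Fin 2 → SimpleGraph V) : Prop where
  injective : Function.Injective x
  cover : page 0 ⊔ page 1 = G
  disjoint : Disjoint (page 0) (page 1)
  nonCrossing : ∀ i, NonCrossing (page i) x

theorem Equiv.Perm.orbit_of_ncard {α : Type*} [Finite α] (f : Equiv.Perm α) (a : α) {m : ℕ}
    (hm : {b | f.SameCycle a b}.ncard = m) :
    (f ^ m) a = a ∧ (∀ b, f.SameCycle a b → ∃ k < m, (f ^ k) a = b) ∧
      ∀ j < m, ∀ k < m, (f ^ j) a = (f ^ k) a → j = k := by
  have hpos : 0 < Function.minimalPeriod f a :=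
    Function.minimalPeriod_pos_of_mem_periodicPts
      (f.injective.mem_periodicPts a)
  have hset : {b | f.SameCycle a b} =
      (fun k => (f ^ k) a) '' (Set.Iio (Function.minimalPeriod f a)) := by
    ext b
    constructor
    · intro h
      obtain ⟨i, -, hi⟩ := h.exists_pow_eq'
      refine ⟨i % Function.minimalPeriod f a, Nat.mod_lt _ hpos, ?_⟩
      rw [← hi]
      simp only [← Equiv.Perm.iterate_eq_pow]
      exact Function.iterate_mod_minimalPeriod_eq
    · rintro ⟨k, -, rfl⟩
      exact ⟨k, by simp⟩
  have hinj : Set.InjOn (fun k => (f ^ k) a) (Set.Iio (Function.minimalPeriod f a)) := by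
    simpa only [Equiv.Perm.iterate_eq_pow] using
      Function.iterate_injOn_Iio_minimalPeriod (f := f) (x := a)
  have hp : Function.minimalPeriod f a = m := by
    rw [← hm, hset, hinj.ncard_image, ← Finset.coe_Iio, Set.ncard_coe_finset,
      Nat.card_Iio]
  rw [hp] at hset hinj
  refine ⟨?_, fun b hb => ?_, fun j hj k hk h => hinj hj hk h⟩
  · rw [← hp, ← Equiv.Perm.iterate_eq_pow]
    exact Function.iterate_minimalPeriod
  · have : b ∈ {b | f.SameCycle a b} := hb
    rw [hset] at this
    exact this

instance SimpleGraph.Dart.instFinite {V : Type*} [Finite V] {G : SimpleGraph V} : Finite G.Dart :=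
  Finite.of_injective _ SimpleGraph.Dart.toProd_injective

theorem SimpleGraph.Dart.induction_of_rot {V : Type*} {G : SimpleGraph V} (hG : G.Preconnected)
    (R : RotationSystem G) {p : G.Dart → Prop} (hrot : ∀ d, p d → p (R.rot d))
    (hsymm : ∀ d, p d → p d.symm) [Finite V] {d : G.Dart} (hd : p d) (e : G.Dart) : p e := by
  have hrot' : ∀ d e : G.Dart, d.fst = e.fst → p d → p e := by
    intro d e h hd
    obtain ⟨n, -, rfl⟩ := (R.rot_cyclic d e h).exists_pow_eq'
    clear h
    induction n with
    | zero => simpa using hd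
    | succ n ih => rw [pow_succ', Equiv.Perm.mul_apply]; exact hrot _ ih
  suffices ∀ u v : V, G.Reachable u v → ∀ d e : G.Dart, d.fst = u → e.fst = v → p d → p e from
    this _ _ (hG d.fst e.fst) d e rfl rfl hd
  rintro u v ⟨w⟩
  induction w with
  | nil => intro d e hd he; exact hrot' d e (hd.trans he.symm)
  | cons h w ih =>
    intro d e hd he hp
    exact ih (SimpleGraph.Dart.symm ⟨(_, _), h⟩) e rfl he (hsymm _ (hrot' d ⟨(_, _), h⟩ hd hp))

namespace RotationSystem

variable {V : Type*} {G : SimpleGraph V} (R : RotationSystem G)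

theorem next_apply (d : G.Dart) : R.next d = R.rot d.symm := rfl

theorem next_symm (d : G.Dart) : R.next d.symm = R.rot d := by
  rw [next_apply, SimpleGraph.Dart.symm_symm]

@[simp] theorem next_fst (d : G.Dart) : (R.next d).fst = d.snd := R.rot_fst _

theorem right_eq_right {d e : G.Dart} : R.right d = R.right e ↔ R.next.SameCycle d e :=
  Quotient.eq (r := Equiv.Perm.SameCycle.setoid R.next)

@[simp] theorem right_next (d : G.Dart) : R.right (R.next d) = R.right d :=
  R.right_eq_right.2 (Equiv.Perm.sameCycle_apply_left.2 (Equiv.Perm.SameCycle.refl _ _))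

theorem right_rot (d : G.Dart) : R.right (R.rot d) = R.left d := by
  rw [← next_symm, right_next, left]

theorem right_symm (d : G.Dart) : R.right d.symm = R.left d := rfl

theorem left_symm (d : G.Dart) : R.left d.symm = R.right d := by
  rw [left, SimpleGraph.Dart.symm_symm]

instance [Finite V] : Finite R.Face :=
  Quotient.finite _

end RotationSystem

namespace Quadrangulation

variable {V : Type*} {Q : Quadrangulation V} {lab : Q.graph.Dart → Fin 2}

theorem fst_mem_black_iff (d : Q.graph.Dart) : d.fst ∈ Q.black ↔ d.snd ∉ Q.black := by
  rcases Q.bipartite.mem_of_adj d.adj with h | h <;> simp_all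

variable (Q) in
theorem orbit_next [Finite V] (d : Q.graph.Dart) : (Q.emb.next ^ 4) d = d ∧
    (∀ e, Q.emb.right e = Q.emb.right d → ∃ k < 4, (Q.emb.next ^ k) d = e) := by
  have h4 : {e | Q.emb.next.SameCycle d e}.ncard = 4 := by
    rw [← Q.face_degree (Q.emb.right d)]
    congr 1
    ext e
    simp [RotationSystem.right_eq_right, Equiv.Perm.sameCycle_comm]
  obtain ⟨h1, h2, -⟩ := Equiv.Perm.orbit_of_ncard Q.emb.next d h4
  exact ⟨h1, fun e he => h2 e (Q.emb.right_eq_right.1 he.symm)⟩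

variable (Q) in
theorem orbit_rot [Finite V] (d : Q.graph.Dart) :
    (Q.emb.rot ^ (Q.graph.neighborSet d.fst).ncard) d = d ∧
    (∀ e : Q.graph.Dart, e.fst = d.fst → ∃ k < (Q.graph.neighborSet d.fst).ncard,
      (Q.emb.rot ^ k) d = e) := by
  have h : {e | Q.emb.rot.SameCycle d e}.ncard = (Q.graph.neighborSet d.fst).ncard := by
    have hfst : ∀ e, Q.emb.rot.SameCycle d e → e.fst = d.fst := by
      intro e he
      obtain ⟨n, -, rfl⟩ := he.exists_pow_eq'
      clear he
      induction n with
      | zero => rfl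
      | succ n ih => rw [pow_succ', Equiv.Perm.mul_apply, Q.emb.rot_fst, ih]
    refine Set.ncard_congr (fun e _ => e.snd) ?_ ?_ ?_
    · intro e he
      have := e.adj
      rwa [hfst e he] at this
    · intro e e' he he' h
      exact SimpleGraph.Dart.ext _ _ (Prod.ext ((hfst e he).trans (hfst e' he').symm) h)
    · intro w hw
      exact ⟨⟨(d.fst, w), hw⟩, Q.emb.rot_cyclic _ _ rfl, rfl⟩
  obtain ⟨h1, h2, -⟩ := Equiv.Perm.orbit_of_ncard Q.emb.rot d h
  exact ⟨h1, fun e he => h2 e (Q.emb.rot_cyclic _ _ he.symm)⟩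

/-- The vertices other than `s 0` and `s 1`. -/
abbrev Inner (Q : Quadrangulation V) : Type _ := {v : V // ∀ i, v ≠ Q.s i}

namespace IsStrongLabeling

variable (hlab : Q.IsStrongLabeling lab)
include hlab

theorem black_iff [Finite V] (d : Q.graph.Dart) :
    d.fst ∈ Q.black ↔ lab d ≠ lab (Q.emb.next d) := by
  have hnext : ∀ d, (d.fst ∈ Q.black ↔ lab d ≠ lab (Q.emb.next d)) →
      ((Q.emb.next d).fst ∈ Q.black ↔ lab (Q.emb.next d) ≠ lab (Q.emb.next (Q.emb.next d))) := by
    intro d hd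
    have hlabels : lab (Q.emb.next d) ≠ lab (Q.emb.next (Q.emb.next d)) ↔
        ¬ lab d ≠ lab (Q.emb.next d) := by
      obtain ⟨e, he, h0, h1, h2, h3⟩ := hlab.face_rule (Q.emb.right d)
      obtain ⟨h4, hk⟩ := Q.orbit_next e
      obtain ⟨k, hk, rfl⟩ := hk d he.symm
      simp only [pow_succ', pow_zero, Equiv.Perm.mul_apply, Equiv.Perm.one_apply] at *
      interval_cases k <;>
        simp [pow_succ', h0, h1, h2, h3, h4]
    rw [hlabels, ← hd, RotationSystem.next_fst, fst_mem_black_iff, not_not]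
  have hsymm : ∀ d, (d.fst ∈ Q.black ↔ lab d ≠ lab (Q.emb.next d)) →
      (d.symm.fst ∈ Q.black ↔ lab d.symm ≠ lab (Q.emb.next d.symm)) := by
    intro d hd
    have h := hlab.edge_rule d
    rw [Q.emb.next_symm]
    rw [Q.emb.next_apply] at hd
    have hb := fst_mem_black_iff d
    change d.snd ∈ Q.black ↔ _
    revert h hd hb
    generalize lab d = p
    generalize lab d.symm = q
    generalize lab (Q.emb.rot d) = r
    generalize lab (Q.emb.rot d.symm) = t
    intro hd h hb
    have key : ∀ p q r t : Fin 2, Xor (p = r) (q = t) → (p ≠ t ↔ ¬ q ≠ r) := by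
      unfold Xor
      decide
    have := key p q r t h
    tauto
  obtain ⟨d₀, hd₀, hout⟩ := Q.s_outer 0
  refine SimpleGraph.Dart.induction_of_rot Q.connected.preconnected Q.emb ?_ hsymm (d := d₀) ?_ d
  · intro d hd
    rw [← Q.emb.next_symm]
    exact hnext _ (hsymm _ hd)
  · obtain ⟨h0, h1, h2, h3⟩ := hlab.outer_rule d₀ hout hd₀
    have : (Q.emb.next⁻¹ ^ 3) d₀ = Q.emb.next d₀ := by
      rw [inv_pow, Equiv.Perm.inv_eq_iff_eq, ← Equiv.Perm.mul_apply, ← pow_succ,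
        (Q.orbit_next d₀).1]
    rw [← this, h0, h3]
    simpa [hd₀] using Q.s_black 0

theorem black_iff_rot [Finite V] (d : Q.graph.Dart) :
    d.fst ∈ Q.black ↔ lab (Q.emb.rot d) = lab d.symm := by
  have := hlab.black_iff d.symm
  rw [Q.emb.next_symm] at this
  rw [fst_mem_black_iff, eq_comm]
  change d.snd ∈ Q.black ↔ _ at this
  tauto

theorem existsUnique_turn [Finite V] (j : Fin 2) (v : Q.Inner) :
    ∃! d : Q.graph.Dart, d.fst = v ∧ lab d = j ∧ lab (Q.emb.rot d) ≠ j := by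
  obtain ⟨d, hd, k, hk0, hkm, hk⟩ := hlab.vertex_rule v v.2
  obtain ⟨hm, hall⟩ := Q.orbit_rot d
  rw [hd] at hm hall
  generalize (Q.graph.neighborSet (v : V)).ncard = m at *
  have hfst : ∀ t, ((Q.emb.rot ^ t) d).fst = v := by
    intro t
    induction t with
    | zero => exact hd
    | succ t ih => rw [pow_succ', Equiv.Perm.mul_apply, Q.emb.rot_fst, ih]
  have hsucc : ∀ t < m, lab (Q.emb.rot ((Q.emb.rot ^ t) d)) = 0 ↔ (t + 1 < k ∨ t + 1 = m) := by
    intro t ht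
    rw [← Equiv.Perm.mul_apply, ← pow_succ']
    rcases Nat.lt_or_ge (t + 1) m with h | h
    · rw [hk _ h]; omega
    · have : t + 1 = m := by omega
      rw [this, hm]
      have := hk 0 (by omega)
      simp only [pow_zero, Equiv.Perm.one_apply] at this
      rw [this]; omega
  have hj : ∀ a b : Fin 2, (a = j ∧ b ≠ j) ↔ ((a = 0 ↔ j = 0) ∧ (b = 0 ↔ j ≠ 0)) := by
    revert j; decide
  by_cases h0 : j = 0
  · refine ⟨(Q.emb.rot ^ (k - 1)) d, ⟨hfst _, ?_⟩, ?_⟩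
    · rw [hj, hk _ (by omega), hsucc _ (by omega)]
      simp only [h0, ne_eq, not_true_eq_false, iff_true, iff_false]; omega
    · rintro e ⟨he, he'⟩
      obtain ⟨t, ht, rfl⟩ := hall e he
      rw [hj, hk _ ht, hsucc _ ht] at he'
      simp only [h0, ne_eq, not_true_eq_false, iff_true, iff_false] at he'
      have : t = k - 1 := by omega
      rw [this]
  · refine ⟨(Q.emb.rot ^ (m - 1)) d, ⟨hfst _, ?_⟩, ?_⟩
    · rw [hj, hk _ (by omega), hsucc _ (by omega)]
      simp only [h0, ne_eq, not_false_eq_true, iff_true, iff_false]; omega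
    · rintro e ⟨he, he'⟩
      obtain ⟨t, ht, rfl⟩ := hall e he
      rw [hj, hk _ ht, hsucc _ ht] at he'
      simp only [h0, ne_eq, not_false_eq_true, iff_true, iff_false] at he'
      have : t = m - 1 := by omega
      rw [this]

omit hlab

/-- The dart at `v` at which the labels, in counterclockwise order, change from `j` to `1 - j`. -/
noncomputable def turn [Finite V] (hlab : Q.IsStrongLabeling lab) (j : Fin 2) (v : Q.Inner) :
    Q.graph.Dart :=
  (hlab.existsUnique_turn j v).choose

end IsStrongLabeling

end Quadrangulation

theorem Fin.ne_iff_eq_one_sub (a i : Fin 2) : a ≠ i ↔ a = 1 - i := by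
  revert a i; decide

theorem Fin.one_sub_one_sub (i : Fin 2) : 1 - (1 - i) = i := by
  revert i; decide

namespace Quadrangulation

variable {V : Type*} {Q : Quadrangulation V} {lab : Q.graph.Dart → Fin 2}

variable (Q lab) in
/-- The edges of colour `i` that are directed towards `v`. -/
noncomputable def inDarts [Finite V] (i : Fin 2) (v : V) : Finset Q.graph.Dart :=
  (Set.toFinite {e | e ∈ Q.T lab i ∧ e.snd = v}).toFinset

@[simp] theorem mem_inDarts [Finite V] {i : Fin 2} {v : V} {e : Q.graph.Dart} :
    e ∈ Q.inDarts lab i v ↔ e ∈ Q.T lab i ∧ e.snd = v := by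
  simp [inDarts]

namespace IsStrongLabeling

variable [Finite V] (hlab : Q.IsStrongLabeling lab)

theorem turn_fst (j : Fin 2) (v : Q.Inner) : (hlab.turn j v).fst = v :=
  (hlab.existsUnique_turn j v).choose_spec.1.1

theorem lab_turn (j : Fin 2) (v : Q.Inner) : lab (hlab.turn j v) = j :=
  (hlab.existsUnique_turn j v).choose_spec.1.2.1

theorem lab_rot_turn (j : Fin 2) (v : Q.Inner) : lab (Q.emb.rot (hlab.turn j v)) ≠ j :=
  (hlab.existsUnique_turn j v).choose_spec.1.2.2

theorem eq_turn {j : Fin 2} {v : Q.Inner} {d : Q.graph.Dart} (hd : d.fst = v) (h : lab d = j)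
    (h' : lab (Q.emb.rot d) ≠ j) : d = hlab.turn j v :=
  (hlab.existsUnique_turn j v).choose_spec.2 d ⟨hd, h, h'⟩

section
include hlab

omit [Finite V] in
theorem symm_mem_T_iff {i : Fin 2} {d : Q.graph.Dart} :
    d.symm ∈ Q.T lab i ↔ lab d = i ∧ lab (Q.emb.rot d) = i := by
  have h := hlab.edge_rule d
  simp only [T, Set.mem_ofPred_eq, SimpleGraph.Dart.symm_symm]
  constructor
  · exact fun h => h.2
  · rintro ⟨h1, h2⟩
    refine ⟨?_, h1, h2⟩
    rcases h with h | h
    · exact h.2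
    · exact absurd (h1.trans h2.symm) h.2

theorem mem_T_iff_of_mem_black {i : Fin 2} {d : Q.graph.Dart} (hd : d.fst ∈ Q.black) :
    d ∈ Q.T lab i ↔ lab d ≠ i ∧ lab (Q.emb.rot d) = i := by
  have h := (hlab.black_iff_rot d).1 hd
  constructor
  · rintro ⟨h1, h2, h3⟩
    rw [h, h2] at h1
    exact ⟨h1, h.trans h2⟩
  · rintro ⟨h1, h2⟩
    have h4 := hlab.edge_rule d
    rw [h2] at h4
    rcases h4 with h4 | h4
    · exact absurd h4.1 h1
    · exact ⟨h2 ▸ h1, h ▸ h2, h4.1 ▸ h ▸ h2⟩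

theorem mem_T_iff_of_notMem_black {i : Fin 2} {d : Q.graph.Dart} (hd : d.fst ∉ Q.black) :
    d ∈ Q.T lab i ↔ lab d = i ∧ lab (Q.emb.rot d) ≠ i := by
  have h := hlab.black_iff d
  rw [Q.emb.next_apply] at h
  have h : lab d = lab (Q.emb.rot d.symm) := by tauto
  constructor
  · rintro ⟨h1, h2, h3⟩
    rw [h, h3] at h1
    exact ⟨h.trans h3, h1.symm⟩
  · rintro ⟨h1, h2⟩
    have h4 := hlab.edge_rule d
    rw [h1] at h4
    rcases h4 with h4 | h4
    · exact absurd h4.1.symm h2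
    · exact ⟨h1 ▸ h2.symm, (h4.1.trans h.symm).trans h1, h.symm.trans h1⟩

omit [Finite V] in
theorem fst_ne_s {i : Fin 2} {d : Q.graph.Dart} (hd : d ∈ Q.T lab i) (j : Fin 2) :
    d.fst ≠ Q.s j := by
  intro h
  exact hd.1 ((hlab.special j d h).trans (hlab.special j _ ((Q.emb.rot_fst d).trans h)).symm)

omit [Finite V] in
theorem eq_of_snd_eq_s {i j : Fin 2} {d : Q.graph.Dart} (hd : d ∈ Q.T lab i)
    (h : d.snd = Q.s j) : j = i :=
  (hlab.special j d.symm h).symm.trans hd.2.1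

omit [Finite V] in
theorem mem_T_or_symm_mem_T (d : Q.graph.Dart) : ∃ i, d ∈ Q.T lab i ∨ d.symm ∈ Q.T lab i := by
  by_cases h : lab d = lab (Q.emb.rot d)
  · exact ⟨lab d, Or.inr (hlab.symm_mem_T_iff.2 ⟨rfl, h.symm⟩)⟩
  · rcases hlab.edge_rule d with h' | h'
    · exact absurd h'.1 h
    · exact ⟨lab d.symm, Or.inl ⟨h, rfl, h'.1.symm⟩⟩

theorem exists_mem_T (i : Fin 2) (v : Q.Inner) : ∃ d ∈ Q.T lab i, d.fst = v := by
  by_cases hv : (v : V) ∈ Q.black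
  · refine ⟨hlab.turn (1 - i) v, ?_, hlab.turn_fst _ _⟩
    rw [hlab.mem_T_iff_of_mem_black (by rwa [turn_fst]), Fin.ne_iff_eq_one_sub]
    refine ⟨hlab.lab_turn _ _, ?_⟩
    have := hlab.lab_rot_turn (1 - i) v
    rwa [Fin.ne_iff_eq_one_sub, Fin.one_sub_one_sub] at this
  · refine ⟨hlab.turn i v, ?_, hlab.turn_fst _ _⟩
    rw [hlab.mem_T_iff_of_notMem_black (by rwa [turn_fst])]
    exact ⟨hlab.lab_turn _ _, hlab.lab_rot_turn _ _⟩

end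

theorem eq_turn_of_mem_black {i : Fin 2} {v : Q.Inner} {d : Q.graph.Dart} (hd : d ∈ Q.T lab i)
    (hv : d.fst = v) (hb : (v : V) ∈ Q.black) : d = hlab.turn (1 - i) v := by
  rw [hlab.mem_T_iff_of_mem_black (by rwa [hv]), Fin.ne_iff_eq_one_sub] at hd
  refine hlab.eq_turn hv hd.1 ?_
  rw [Fin.ne_iff_eq_one_sub, Fin.one_sub_one_sub]
  exact hd.2

theorem eq_turn_of_notMem_black {i : Fin 2} {v : Q.Inner} {d : Q.graph.Dart}
    (hd : d ∈ Q.T lab i) (hv : d.fst = v) (hb : (v : V) ∉ Q.black) : d = hlab.turn i v := by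
  rw [hlab.mem_T_iff_of_notMem_black (by rwa [hv])] at hd
  exact hlab.eq_turn hv hd.1 hd.2

include hlab in
theorem T_unique {i : Fin 2} {d e : Q.graph.Dart} (hd : d ∈ Q.T lab i) (he : e ∈ Q.T lab i)
    (h : d.fst = e.fst) : d = e := by
  let v : Q.Inner := ⟨e.fst, hlab.fst_ne_s he⟩
  by_cases hb : (v : V) ∈ Q.black
  · rw [hlab.eq_turn_of_mem_black (v := v) hd h hb, hlab.eq_turn_of_mem_black (v := v) he rfl hb]
  · rw [hlab.eq_turn_of_notMem_black (v := v) hd h hb,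
      hlab.eq_turn_of_notMem_black (v := v) he rfl hb]

/-- The telescoping sum of `h` over the faces around `v` whose angle has label `i`. -/
theorem sum_inDarts (i : Fin 2) (v : Q.Inner) (h : Q.emb.Face → ℤ) :
    ∑ e ∈ Q.inDarts lab i v, (h (Q.emb.left e) - h (Q.emb.right e)) =
      h (Q.emb.left (hlab.turn (1 - i) v)) - h (Q.emb.right (hlab.turn i v)) := by
  classical
  let S : Finset Q.graph.Dart := (Set.toFinite {d : Q.graph.Dart | d.fst = v}).toFinset
  have hS : ∀ d, d ∈ S ↔ d.fst = v := by simp [S]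
  let φ : Q.graph.Dart → ℤ := fun d => if lab d = i then h (Q.emb.right d) else 0
  have hrot : ∑ d ∈ S, φ (Q.emb.rot d) = ∑ d ∈ S, φ d :=
    Finset.sum_equiv Q.emb.rot (fun d => by rw [hS, hS, Q.emb.rot_fst]) (fun _ _ => rfl)
  have hφ : ∀ d ∈ S, φ (Q.emb.rot d) - φ d =
      (if d = hlab.turn (1 - i) v then h (Q.emb.left d) else 0) -
      (if d = hlab.turn i v then h (Q.emb.right d) else 0) +
      (if d.symm ∈ Q.T lab i then h (Q.emb.left d) - h (Q.emb.right d) else 0) := by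
    intro d hd
    rw [hS] at hd
    have h1 : d = hlab.turn (1 - i) v ↔ lab d ≠ i ∧ lab (Q.emb.rot d) = i := by
      constructor
      · rintro rfl
        have := hlab.lab_rot_turn (1 - i) v
        rw [Fin.ne_iff_eq_one_sub, Fin.one_sub_one_sub] at this
        exact ⟨by rw [Fin.ne_iff_eq_one_sub, hlab.lab_turn], this⟩
      · rintro ⟨h1, h2⟩
        refine hlab.eq_turn hd ((Fin.ne_iff_eq_one_sub _ _).1 h1) ?_
        rw [Fin.ne_iff_eq_one_sub, Fin.one_sub_one_sub, h2]
    have h2 : d = hlab.turn i v ↔ lab d = i ∧ lab (Q.emb.rot d) ≠ i := by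
      constructor
      · rintro rfl
        exact ⟨hlab.lab_turn _ _, hlab.lab_rot_turn _ _⟩
      · rintro ⟨h1, h2⟩
        exact hlab.eq_turn hd h1 h2
    simp only [φ, h1, h2, hlab.symm_mem_T_iff, Q.emb.right_rot]
    by_cases h3 : lab d = i <;> by_cases h4 : lab (Q.emb.rot d) = i <;> simp [h3, h4]
  have hsum := Finset.sum_congr rfl hφ
  rw [Finset.sum_sub_distrib, hrot, sub_self, Finset.sum_add_distrib, Finset.sum_sub_distrib,
    Finset.sum_ite_eq', Finset.sum_ite_eq', if_pos ((hS _).2 (hlab.turn_fst _ _)),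
    if_pos ((hS _).2 (hlab.turn_fst _ _)), ← Finset.sum_filter] at hsum
  have hsymm : ∑ d ∈ S with d.symm ∈ Q.T lab i, (h (Q.emb.left d) - h (Q.emb.right d)) =
      ∑ e ∈ Q.inDarts lab i v, -(h (Q.emb.left e) - h (Q.emb.right e)) := by
    refine Finset.sum_bij' (fun d _ => d.symm) (fun d _ => d.symm) ?_ ?_ ?_ ?_ ?_
    · intro d hd
      rw [Finset.mem_filter, hS] at hd
      exact mem_inDarts.2 ⟨hd.2, hd.1⟩
    · intro d hd
      rw [mem_inDarts] at hd
      rw [Finset.mem_filter, hS, SimpleGraph.Dart.symm_symm]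
      exact ⟨hd.2, hd.1⟩
    · simp
    · simp
    · intro d _
      rw [Q.emb.left_symm, Q.emb.right_symm]
      ring
  rw [hsymm, Finset.sum_neg_distrib] at hsum
  linarith

open Classical in
/-- The face which follows (for `j = 0`) or precedes (for `j = 1`) the vertex `v` on the
equatorial line, the closed curve through all bicoloured angles. -/
noncomputable def slot (j : Fin 2) (v : Q.Inner) : Q.emb.Face :=
  if (v : V) ∈ Q.black then Q.emb.right (hlab.turn j v) else Q.emb.left (hlab.turn j v)

theorem slot_of_mem_black {i : Fin 2} {v : Q.Inner} {d : Q.graph.Dart} (hd : d ∈ Q.T lab i)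
    (hv : d.fst = v) (hb : (v : V) ∈ Q.black) : hlab.slot (1 - i) v = Q.emb.right d := by
  rw [slot, if_pos hb, ← hlab.eq_turn_of_mem_black hd hv hb]

theorem slot_of_notMem_black {i : Fin 2} {v : Q.Inner} {d : Q.graph.Dart} (hd : d ∈ Q.T lab i)
    (hv : d.fst = v) (hb : (v : V) ∉ Q.black) : hlab.slot i v = Q.emb.left d := by
  rw [slot, if_neg hb, ← hlab.eq_turn_of_notMem_black hd hv hb]

/-- Across an edge of `T i`, a function on the faces changes by the sum of the changes across the
edges that end at its tail and of the change at the tail along the equatorial line. -/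
theorem left_sub_right {i : Fin 2} {v : Q.Inner} {d : Q.graph.Dart} (hd : d ∈ Q.T lab i)
    (hv : d.fst = v) (h : Q.emb.Face → ℤ) :
    h (Q.emb.left d) - h (Q.emb.right d) = h (hlab.slot i v) - h (hlab.slot (1 - i) v) +
      ∑ e ∈ Q.inDarts lab i v, (h (Q.emb.left e) - h (Q.emb.right e)) := by
  rw [hlab.sum_inDarts]
  by_cases hb : (v : V) ∈ Q.black
  · rw [hlab.eq_turn_of_mem_black hd hv hb, slot, slot, if_pos hb, if_pos hb]
    ring
  · rw [hlab.eq_turn_of_notMem_black hd hv hb, slot, slot, if_neg hb, if_neg hb]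
    ring

theorem exists_black_dart (j : Fin 2) (v : Q.Inner) : ∃ d : Q.graph.Dart, d.fst ∈ Q.black ∧
    lab d = j ∧ Q.emb.right d = hlab.slot j v ∧
    (d.fst = v ∧ lab d ≠ lab (Q.emb.rot d) ∨ d.snd = v ∧ lab d = lab (Q.emb.rot d)) := by
  by_cases hb : (v : V) ∈ Q.black
  · refine ⟨hlab.turn j v, by rwa [turn_fst], hlab.lab_turn j v, by rw [slot, if_pos hb],
      Or.inl ⟨hlab.turn_fst j v, ?_⟩⟩
    rw [hlab.lab_turn]
    exact (hlab.lab_rot_turn j v).symm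
  · have hT : hlab.turn j v ∈ Q.T lab j := by
      rw [hlab.mem_T_iff_of_notMem_black (by rwa [turn_fst])]
      exact ⟨hlab.lab_turn _ _, hlab.lab_rot_turn _ _⟩
    refine ⟨(hlab.turn j v).symm, ?_, hT.2.1, by rw [slot, if_neg hb, Q.emb.right_symm],
      Or.inr ⟨hlab.turn_fst j v, ?_⟩⟩
    · have := fst_mem_black_iff (hlab.turn j v).symm
      rw [this]
      change (hlab.turn j v).fst ∉ Q.black
      rwa [turn_fst]
    · rw [hT.2.1, hT.2.2]

section
include hlab

theorem black_dart_unique {d e : Q.graph.Dart} (hd : d.fst ∈ Q.black) (he : e.fst ∈ Q.black)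
    (h : Q.emb.right d = Q.emb.right e) (hl : lab d = lab e) : d = e := by
  obtain ⟨a, ha, h0, h1, h2, h3⟩ := hlab.face_rule (Q.emb.right e)
  obtain ⟨h4, hk⟩ := Q.orbit_next a
  obtain ⟨k, hk', rfl⟩ := hk d (h.trans ha.symm)
  obtain ⟨l, hl', rfl⟩ := hk e ha.symm
  have hb := hlab.black_iff ((Q.emb.next ^ k) a)
  have hb' := hlab.black_iff ((Q.emb.next ^ l) a)
  rw [iff_true_left hd] at hb
  rw [iff_true_left he] at hb'
  clear h ha hd he hk
  simp only [pow_succ', pow_zero, Equiv.Perm.mul_apply, Equiv.Perm.one_apply] at *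
  interval_cases k <;> interval_cases l <;>
    simp_all [pow_succ']

theorem exists_black_dart_of_face (j : Fin 2) (F : Q.emb.Face) :
    ∃ d : Q.graph.Dart, d.fst ∈ Q.black ∧ lab d = j ∧ Q.emb.right d = F := by
  obtain ⟨a, ha, h0, h1, h2, h3⟩ := hlab.face_rule F
  obtain ⟨h4, hk⟩ := Q.orbit_next a
  have hb := hlab.black_iff (Q.emb.next a)
  have hb' := hlab.black_iff ((Q.emb.next ^ 3) a)
  simp only [pow_succ', pow_zero, Equiv.Perm.mul_apply, Equiv.Perm.one_apply] at *
  rw [h1, h2] at hb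
  rw [h4, h3, h0] at hb'
  fin_cases j
  · exact ⟨_, hb.2 (by decide), h1, by rw [Q.emb.right_next, ha]⟩
  · exact ⟨_, hb'.2 (by decide), h3, by simp only [Q.emb.right_next, ha]⟩

end

theorem slot_injective (j : Fin 2) : Function.Injective (hlab.slot j) := by
  intro v w h
  obtain ⟨d, hd, hdj, hdr, hdv⟩ := hlab.exists_black_dart j v
  obtain ⟨e, he, hej, her, hev⟩ := hlab.exists_black_dart j w
  obtain rfl := hlab.black_dart_unique hd he (hdr.trans (h.trans her.symm)) (hdj.trans hej.symm)
  apply Subtype.ext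
  rcases hdv with hdv | hdv <;> rcases hev with hev | hev
  · exact hdv.1.symm.trans hev.1
  · exact absurd hev.2 hdv.2
  · exact absurd hdv.2 hev.2
  · exact hdv.1.symm.trans hev.1

theorem slot_eq_right {j : Fin 2} {d : Q.graph.Dart} (hd : d.fst ∈ Q.black) (hj : lab d = j) :
    ∃ v : Q.Inner, hlab.slot j v = Q.emb.right d ∧
      (d.fst = v ∧ d ∈ Q.T lab (1 - j) ∨ d.snd = v ∧ d.symm ∈ Q.T lab j) := by
  by_cases h : lab d = lab (Q.emb.rot d)
  · have hT : d.symm ∈ Q.T lab j := hlab.symm_mem_T_iff.2 ⟨hj, h ▸ hj⟩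
    refine ⟨⟨d.snd, hlab.fst_ne_s hT⟩, ?_, Or.inr ⟨rfl, hT⟩⟩
    rw [hlab.slot_of_notMem_black hT rfl ((fst_mem_black_iff d).1 hd), Q.emb.left_symm]
  · have hT : d ∈ Q.T lab (1 - j) := by
      rw [hlab.mem_T_iff_of_mem_black hd, Fin.ne_iff_eq_one_sub, Fin.one_sub_one_sub,
        ← Fin.ne_iff_eq_one_sub]
      exact ⟨hj, fun h' => h (hj.trans h'.symm)⟩
    refine ⟨⟨d.fst, hlab.fst_ne_s hT⟩, ?_, Or.inl ⟨rfl, hT⟩⟩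
    rw [← hlab.slot_of_mem_black (v := ⟨d.fst, hlab.fst_ne_s hT⟩) hT rfl hd, Fin.one_sub_one_sub]

theorem slot_surjective (j : Fin 2) : Function.Surjective (hlab.slot j) := by
  intro F
  obtain ⟨d, hd, hdj, rfl⟩ := hlab.exists_black_dart_of_face j F
  obtain ⟨v, hv, -⟩ := hlab.slot_eq_right hd hdj
  exact ⟨v, hv⟩

noncomputable def slotEquiv (j : Fin 2) : Q.Inner ≃ Q.emb.Face :=
  Equiv.ofBijective _ ⟨hlab.slot_injective j, hlab.slot_surjective j⟩

@[simp] theorem slotEquiv_apply (j : Fin 2) (v : Q.Inner) : hlab.slotEquiv j v = hlab.slot j v :=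
  rfl

/-- The successor of an inner vertex on the equatorial line. -/
noncomputable def succ : Equiv.Perm Q.Inner := (hlab.slotEquiv 0).trans (hlab.slotEquiv 1).symm

theorem slot_one_succ (v : Q.Inner) : hlab.slot 1 (hlab.succ v) = hlab.slot 0 v := by
  rw [← slotEquiv_apply, succ, Equiv.trans_apply, Equiv.apply_symm_apply, slotEquiv_apply]

end IsStrongLabeling

end Quadrangulation

namespace Quadrangulation

variable {V : Type*} {Q : Quadrangulation V} {lab : Q.graph.Dart → Fin 2}

theorem Reaches.refl {i : Fin 2} (v : V) : Q.Reaches lab i v v := Relation.ReflTransGen.refl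

theorem Reaches.of_mem_T {i : Fin 2} {d : Q.graph.Dart} (hd : d ∈ Q.T lab i) :
    Q.Reaches lab i d.fst d.snd :=
  Relation.ReflTransGen.single ⟨d, hd, rfl, rfl⟩

namespace IsStrongLabeling

variable [Finite V] (hlab : Q.IsStrongLabeling lab)

section
include hlab

theorem rightUnique_T (i : Fin 2) :
    Relator.RightUnique fun u v => ∃ d ∈ Q.T lab i, d.fst = u ∧ d.snd = v := by
  rintro u v w ⟨d, hd, rfl, rfl⟩ ⟨e, he, h, rfl⟩
  rw [hlab.T_unique he hd h]

theorem reaches_total {i : Fin 2} {u v w : V} (hv : Q.Reaches lab i u v)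
    (hw : Q.Reaches lab i u w) : Q.Reaches lab i v w ∨ Q.Reaches lab i w v :=
  Relation.ReflTransGen.total_of_right_unique (hlab.rightUnique_T i) hv hw

theorem reaches_fst_iff {i : Fin 2} {d : Q.graph.Dart} (hd : d ∈ Q.T lab i) {w : V} :
    Q.Reaches lab i d.fst w ↔ d.fst = w ∨ Q.Reaches lab i d.snd w := by
  constructor
  · intro h
    rcases Relation.ReflTransGen.cases_head h with h | ⟨x, ⟨e, he, h1, rfl⟩, h2⟩
    · exact Or.inl h
    · rw [hlab.T_unique hd he h1.symm]
      exact Or.inr h2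
  · rintro (h | h)
    · rw [h]; exact Relation.ReflTransGen.refl
    · exact Relation.ReflTransGen.trans (Reaches.of_mem_T hd) h

omit [Finite V] in
theorem reaches_s_iff {i j : Fin 2} {w : V} : Q.Reaches lab i (Q.s j) w ↔ w = Q.s j := by
  constructor
  · intro h
    rcases Relation.ReflTransGen.cases_head h with h | ⟨x, ⟨e, he, h1, rfl⟩, h2⟩
    · exact h.symm
    · exact absurd h1 (hlab.fst_ne_s he j)
  · rintro rfl
    exact Relation.ReflTransGen.refl

omit [Finite V] in
theorem eq_of_reaches_s {i : Fin 2} {v : V} (h : Q.Reaches lab i v (Q.s (1 - i))) :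
    v = Q.s (1 - i) := by
  rcases Relation.ReflTransGen.cases_tail h with h | ⟨x, -, e, he, -, h1⟩
  · exact h.symm
  · have := hlab.eq_of_snd_eq_s he h1
    exact absurd this (by clear * -; revert i; decide)

theorem fst_reaches_iff_snd_reaches {i : Fin 2} {d : Q.graph.Dart} (hd : d ∈ Q.T lab i) :
    Q.Reaches lab i d.fst (Q.s i) ↔ Q.Reaches lab i d.snd (Q.s i) := by
  rw [hlab.reaches_fst_iff hd]
  exact or_iff_right (hlab.fst_ne_s hd i)

theorem reaches_antisymm' {i : Fin 2} {v w : V} (hs : Q.Reaches lab i v (Q.s i))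
    (h : Q.Reaches lab i v w) (h' : Q.Reaches lab i w v) : v = w := by
  induction hs using Relation.ReflTransGen.head_induction_on generalizing w with
  | refl => exact (hlab.reaches_s_iff.1 h).symm
  | head hvb _ ih =>
    obtain ⟨d, hd, rfl, rfl⟩ := hvb
    rcases (hlab.reaches_fst_iff hd).1 h with h | h
    · exact h
    · have h1 := ih h (Relation.ReflTransGen.trans h' (Reaches.of_mem_T hd))
      rw [← h1] at h'
      exact absurd (ih h' (Reaches.of_mem_T hd)).symm d.adj.ne

/-- Induction from the leaves of `T i`. -/
theorem eq_zero_of_eq_sum {i : Fin 2} (G : Q.graph.Dart → ℤ)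
    (hG : ∀ d ∈ Q.T lab i, G d = ∑ e ∈ Q.inDarts lab i d.fst, G e) {d : Q.graph.Dart}
    (hd : d ∈ Q.T lab i) (hs : Q.Reaches lab i d.fst (Q.s i)) : G d = 0 := by
  let r : V → V → Prop := fun u v => Q.Reaches lab i u v ∧ u ≠ v ∧ Q.Reaches lab i v (Q.s i)
  have : IsTrans V r := ⟨fun u v w h h' => ⟨Relation.ReflTransGen.trans h.1 h'.1, by
    rintro rfl
    exact h'.2.1 (hlab.reaches_antisymm' h.2.2 h'.1 h.1), h'.2.2⟩⟩
  have : Std.Irrefl r := ⟨fun u h => h.2.1 rfl⟩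
  have wf : WellFounded r := Finite.wellFounded_of_trans_of_irrefl r
  suffices ∀ v, Q.Reaches lab i v (Q.s i) → ∀ d ∈ Q.T lab i, d.fst = v → G d = 0 from
    this _ hs d hd rfl
  intro v
  induction v using wf.induction with
  | h v ih =>
    rintro hv d hd rfl
    rw [hG d hd]
    refine Finset.sum_eq_zero fun e he => ?_
    rw [mem_inDarts] at he
    refine ih e.fst ⟨he.2 ▸ Reaches.of_mem_T he.1, he.2 ▸ e.adj.ne, hv⟩ ?_ e he.1 rfl
    rw [hlab.fst_reaches_iff_snd_reaches he.1, he.2]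
    exact hv

end

/-- A function on the faces that is constant along the equatorial line agrees on both sides of
an edge of the tree of `s i`. -/
theorem left_eq_right_of_slot_eq {h : Q.emb.Face → ℤ}
    (hh : ∀ v, h (hlab.slot 0 v) = h (hlab.slot 1 v)) {i : Fin 2} {d : Q.graph.Dart}
    (hd : d ∈ Q.T lab i) (hs : Q.Reaches lab i d.fst (Q.s i)) :
    h (Q.emb.left d) = h (Q.emb.right d) := by
  refine sub_eq_zero.1 (hlab.eq_zero_of_eq_sum
    (fun d => h (Q.emb.left d) - h (Q.emb.right d)) (fun d hd => ?_) hd hs)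
  have := hlab.left_sub_right (v := ⟨d.fst, hlab.fst_ne_s hd⟩) hd rfl h
  rw [this, add_eq_right, sub_eq_zero]
  fin_cases i
  · exact hh _
  · exact (hh _).symm

theorem right_eq_right_turn {h : Q.emb.Face → ℤ} {i : Fin 2} {v : Q.Inner}
    (hv : ∀ e ∈ Q.inDarts lab i v, h (Q.emb.left e) = h (Q.emb.right e)) {d : Q.graph.Dart}
    (hd : d.fst = v) (hi : lab d = i) : h (Q.emb.right d) = h (Q.emb.right (hlab.turn i v)) := by
  by_contra hne
  let p : Q.graph.Dart → Prop := fun e => e.fst = v ∧ lab e = i ∧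
    h (Q.emb.right e) ≠ h (Q.emb.right (hlab.turn i v))
  have hp : ∀ e, p e → p (Q.emb.rot e) := by
    rintro e ⟨h1, h2, h3⟩
    have h4 : lab (Q.emb.rot e) = i := by
      by_contra h4
      exact h3 (by rw [← hlab.eq_turn h1 h2 h4])
    refine ⟨(Q.emb.rot_fst e).trans h1, h4, ?_⟩
    have := hv e.symm (mem_inDarts.2 ⟨hlab.symm_mem_T_iff.2 ⟨h2, h4⟩, h1⟩)
    rw [Q.emb.right_rot, ← Q.emb.right_symm, ← this, Q.emb.left_symm]
    exact h3
  have hturn : p (hlab.turn (1 - i) v) := by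
    obtain ⟨n, -, hn⟩ := (Q.emb.rot_cyclic d (hlab.turn (1 - i) v)
      (hd.trans (hlab.turn_fst _ _).symm)).exists_pow_eq'
    rw [← hn]
    clear hn
    induction n with
    | zero => exact ⟨hd, hi, hne⟩
    | succ n ih => rw [pow_succ', Equiv.Perm.mul_apply]; exact hp _ ih
  have := hturn.2.1
  rw [hlab.lab_turn] at this
  exact absurd this (by clear * -; revert i; decide)

section
include hlab

theorem right_eq_outer_at_s {h : Q.emb.Face → ℤ} {i : Fin 2}
    (hs : ∀ e ∈ Q.T lab i, e.snd = Q.s i → h (Q.emb.left e) = h (Q.emb.right e))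
    {d : Q.graph.Dart} (hd : d.fst = Q.s i) : h (Q.emb.right d) = h Q.outer := by
  obtain ⟨d₀, hd₀, hout⟩ := Q.s_outer i
  obtain ⟨n, -, rfl⟩ := (Q.emb.rot_cyclic d₀ d (hd₀.trans hd.symm)).exists_pow_eq'
  clear hd
  suffices ((Q.emb.rot ^ n) d₀).fst = Q.s i ∧ h (Q.emb.right ((Q.emb.rot ^ n) d₀)) = h Q.outer
    from this.2
  induction n with
  | zero => exact ⟨hd₀, by rw [← hout]; rfl⟩
  | succ n ih =>
    rw [pow_succ', Equiv.Perm.mul_apply]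
    generalize (Q.emb.rot ^ n) d₀ = e at ih
    have he := (Q.emb.rot_fst e).trans ih.1
    have := hs e.symm (hlab.symm_mem_T_iff.2 ⟨hlab.special i e ih.1, hlab.special i _ he⟩) ih.1
    exact ⟨he, by rw [Q.emb.right_rot, ← ih.2, ← Q.emb.left_symm, this]; rfl⟩

end

theorem slot_eq_outer_of_reaches {h : Q.emb.Face → ℤ}
    (hh : ∀ v, h (hlab.slot 0 v) = h (hlab.slot 1 v)) {i : Fin 2} (v : Q.Inner)
    (hv : Q.Reaches lab i v (Q.s i)) : h (hlab.slot 0 v) = h Q.outer := by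
  have hslot : ∀ (j : Fin 2) v, h (hlab.slot j v) = h (hlab.slot 0 v) := by
    intro j v
    fin_cases j
    · rfl
    · exact (hh v).symm
  suffices ∀ x, Q.Reaches lab i x (Q.s i) → ∀ v : Q.Inner, x = v →
      h (hlab.slot 0 v) = h Q.outer from this v hv v rfl
  intro x hx
  induction hx using Relation.ReflTransGen.head_induction_on with
  | refl => intro v hv; exact absurd hv.symm (v.2 i)
  | head hxb hb ih =>
    rintro v rfl
    obtain ⟨d, hd, hdv, rfl⟩ := hxb
    have hlr := hlab.left_eq_right_of_slot_eq hh hd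
      ((hlab.fst_reaches_iff_snd_reaches hd).2 hb)
    have hleft : h (Q.emb.left d) = h Q.outer := by
      by_cases hsi : d.snd = Q.s i
      · refine hlab.right_eq_outer_at_s (fun e he hei => ?_) (d := d.symm) hsi
        refine hlab.left_eq_right_of_slot_eq hh he ?_
        rw [hlab.fst_reaches_iff_snd_reaches he, hei]
        exact Relation.ReflTransGen.refl
      · have hin : ∀ j, d.snd ≠ Q.s j := by
          rintro j hj
          exact hsi (hlab.eq_of_snd_eq_s hd hj ▸ hj)
        rw [← ih ⟨d.snd, hin⟩ rfl, ← hslot i]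
        have h1 : h (Q.emb.left d) = h (Q.emb.right (hlab.turn i ⟨d.snd, hin⟩)) := by
          refine hlab.right_eq_right_turn (v := ⟨d.snd, hin⟩) (fun e he => ?_) (d := d.symm) rfl
            hd.2.1
          rw [mem_inDarts] at he
          refine hlab.left_eq_right_of_slot_eq hh he.1 ?_
          rw [hlab.fst_reaches_iff_snd_reaches he.1, he.2]
          exact hb
        rw [h1]
        obtain ⟨e, he, hev⟩ := hlab.exists_mem_T i ⟨d.snd, hin⟩
        by_cases hbl : d.snd ∈ Q.black
        · rw [slot, if_pos hbl]
        · rw [hlab.slot_of_notMem_black he hev hbl, ← hlab.eq_turn_of_notMem_black he hev hbl]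
          refine (hlab.left_eq_right_of_slot_eq hh he ?_).symm
          rw [hev]
          exact hb
    by_cases hbl : (v : V) ∈ Q.black
    · rw [← hslot (1 - i), hlab.slot_of_mem_black hd hdv hbl, ← hlr, hleft]
    · rw [← hslot i, hlab.slot_of_notMem_black hd hdv hbl, hleft]

theorem reaches_iff_of_slot_eq {i : Fin 2} {u w : Q.Inner}
    (h : hlab.slot i u = hlab.slot (1 - i) w) :
    Q.Reaches lab i u (Q.s i) ↔ Q.Reaches lab i w (Q.s i) := by
  obtain ⟨b, hb, hbi, hbr⟩ := hlab.exists_black_dart_of_face (1 - i) (hlab.slot i u)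
  have hd : (Q.emb.next b).fst ∉ Q.black := by
    rwa [RotationSystem.next_fst, ← fst_mem_black_iff]
  have hdi : lab (Q.emb.next b) = i := by
    have := ((hlab.black_iff b).1 hb).symm
    rwa [hbi, Fin.ne_iff_eq_one_sub, Fin.one_sub_one_sub] at this
  have he : (Q.emb.next (Q.emb.next b)).fst ∈ Q.black := by
    rw [RotationSystem.next_fst]
    have := fst_mem_black_iff (Q.emb.next b)
    tauto
  have hei : lab (Q.emb.next (Q.emb.next b)) = i := by
    have := hlab.black_iff (Q.emb.next b)
    rw [hdi] at this
    have : i = lab (Q.emb.next (Q.emb.next b)) := by tauto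
    exact this.symm
  obtain ⟨u', hu', hu⟩ := hlab.slot_eq_right he hei
  obtain ⟨w', hw', hw⟩ := hlab.slot_eq_right hb hbi
  rw [Q.emb.right_next, Q.emb.right_next, hbr] at hu'
  rw [hbr, h] at hw'
  obtain rfl := hlab.slot_injective _ hu'
  obtain rfl := hlab.slot_injective _ hw'
  have h1 : Q.Reaches lab i u' (Q.s i) ↔ Q.Reaches lab i (Q.emb.next b).snd (Q.s i) := by
    rcases hu with ⟨hu, -⟩ | ⟨hu, hT⟩
    · rw [← hu, RotationSystem.next_fst]
    · rw [← hu, ← Q.emb.next_fst (Q.emb.next b)]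
      exact hlab.fst_reaches_iff_snd_reaches hT
  have h2 : Q.Reaches lab i w' (Q.s i) ↔ Q.Reaches lab i (Q.emb.next b).fst (Q.s i) := by
    rw [RotationSystem.next_fst]
    rcases hw with ⟨hw, hT⟩ | ⟨hw, -⟩
    · rw [Fin.one_sub_one_sub] at hT
      rw [← hw]
      exact hlab.fst_reaches_iff_snd_reaches hT
    · rw [hw]
  rw [h1, h2]
  have hdi' : lab (Q.emb.rot (Q.emb.next b).symm) = i := hei
  by_cases hr : lab (Q.emb.next b).symm = i
  · have : (Q.emb.next b) ∈ Q.T lab i := by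
      rw [← SimpleGraph.Dart.symm_symm (Q.emb.next b)]
      exact hlab.symm_mem_T_iff.2 ⟨hr, hdi'⟩
    exact (hlab.fst_reaches_iff_snd_reaches this).symm
  · have : (Q.emb.next b).symm ∈ Q.T lab i := by
      refine hlab.symm_mem_T_iff.2 ⟨hdi, ?_⟩
      rcases hlab.edge_rule (Q.emb.next b) with h' | h'
      · rw [← h'.1, hdi]
      · exact absurd (h'.1.trans hdi') hr
    exact hlab.fst_reaches_iff_snd_reaches this

/-- The first (for `j = 1`) and last (for `j = 0`) inner vertex on the equatorial line. -/
noncomputable def corner (j : Fin 2) : Q.Inner := (hlab.slotEquiv j).symm Q.outer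

@[simp] theorem slot_corner (j : Fin 2) : hlab.slot j (hlab.corner j) = Q.outer :=
  (hlab.slotEquiv j).apply_symm_apply Q.outer

theorem corner_spec (j : Fin 2) : (hlab.corner j : V) ∉ Q.black ∧
    (∃ e ∈ Q.T lab j, e.fst = hlab.corner j ∧ e.snd = Q.s j ∧ Q.emb.left e = Q.outer) ∧
    ∃ e ∈ Q.T lab (1 - j), e.fst = hlab.corner j ∧ e.snd = Q.s (1 - j) ∧
      Q.emb.right e = Q.outer := by
  obtain ⟨d, hd, hdr⟩ := Q.s_outer j
  obtain ⟨d', hd', hdr'⟩ := Q.s_outer (1 - j)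
  have hdb : d.fst ∈ Q.black := hd ▸ Q.s_black j
  have hdb' : d'.fst ∈ Q.black := hd' ▸ Q.s_black (1 - j)
  have hdj := hlab.special _ _ hd
  have hdj' := hlab.special _ _ hd'
  have hT : d.symm ∈ Q.T lab j :=
    hlab.symm_mem_T_iff.2 ⟨hdj, hlab.special _ _ ((Q.emb.rot_fst d).trans hd)⟩
  have hsnd : d.snd ∉ Q.black := (fst_mem_black_iff d).1 hdb
  have hc : hlab.corner j = ⟨d.snd, hlab.fst_ne_s hT⟩ := by
    apply hlab.slot_injective j
    rw [slot_corner, hlab.slot_of_notMem_black hT rfl hsnd, Q.emb.left_symm, hdr]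
  have hlj : lab (Q.emb.next d) = 1 - j := by
    have := ((hlab.black_iff d).1 hdb).symm
    rwa [hdj, Fin.ne_iff_eq_one_sub] at this
  have hnext : Q.emb.next (Q.emb.next d) = d' := by
    have hb := hlab.black_iff (Q.emb.next d)
    rw [RotationSystem.next_fst] at hb
    refine hlab.black_dart_unique ?_ hdb' (by rw [Q.emb.right_next, Q.emb.right_next, hdr, hdr'])
      (by rw [hdj', ← hlj]; tauto)
    rw [RotationSystem.next_fst]
    have := fst_mem_black_iff (Q.emb.next d)
    rw [RotationSystem.next_fst] at this
    tauto
  have hs : (Q.emb.next d).snd = Q.s (1 - j) := by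
    rw [← RotationSystem.next_fst, hnext, hd']
  rw [hc]
  refine ⟨hsnd, ⟨d.symm, hT, rfl, hd, by rw [Q.emb.left_symm, hdr]⟩,
    ⟨Q.emb.next d, ?_, Q.emb.next_fst d, hs, by rw [Q.emb.right_next, hdr]⟩⟩
  rw [← SimpleGraph.Dart.symm_symm (Q.emb.next d)]
  exact hlab.symm_mem_T_iff.2 ⟨hlab.special _ _ hs,
    hlab.special _ _ ((Q.emb.rot_fst _).trans hs)⟩

theorem corner_reaches (i j : Fin 2) : Q.Reaches lab i (hlab.corner j) (Q.s i) := by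
  obtain ⟨-, ⟨e, he, h1, h2, -⟩, ⟨e', he', h1', h2', -⟩⟩ := hlab.corner_spec j
  by_cases h : i = j
  · subst h
    rw [← h1, ← h2]
    exact Reaches.of_mem_T he
  · rw [← ne_eq, Fin.ne_iff_eq_one_sub] at h
    subst h
    rw [← h1', ← h2']
    exact Reaches.of_mem_T he'

theorem succ_corner : hlab.succ (hlab.corner 0) = hlab.corner 1 := by
  apply hlab.slot_injective 1
  rw [slot_one_succ, slot_corner, slot_corner]

theorem eq_of_right_eq_outer {d : Q.graph.Dart} (hd : Q.emb.right d = Q.outer) :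
    ∃ j, d.fst = Q.s j ∨ d.fst = hlab.corner j := by
  by_cases hb : d.fst ∈ Q.black
  · obtain ⟨e, he, her⟩ := Q.s_outer (lab d)
    refine ⟨lab d, Or.inl ?_⟩
    rw [← he, hlab.black_dart_unique hb (he ▸ Q.s_black _) (hd.trans her.symm)
      (hlab.special _ _ he).symm]
  · refine ⟨1 - lab d, Or.inr ?_⟩
    obtain ⟨-, -, e, he, h1, h2, h3⟩ := hlab.corner_spec (1 - lab d)
    rw [Fin.one_sub_one_sub] at h2 he
    rw [← h1]
    congr 2
    apply Q.emb.next.injective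
    have hbl := hlab.black_iff d
    refine hlab.black_dart_unique ?_ ?_ (by rw [Q.emb.right_next, Q.emb.right_next, hd, h3]) ?_
    · rw [RotationSystem.next_fst]
      have := fst_mem_black_iff d
      tauto
    · rw [RotationSystem.next_fst, h2]
      exact Q.s_black _
    · rw [hlab.special (lab d) (Q.emb.next e) ((Q.emb.next_fst e).trans h2)]
      symm
      tauto

theorem reaches_iff_sameCycle (i : Fin 2) (v : Q.Inner) :
    Q.Reaches lab i v (Q.s i) ↔ hlab.succ.SameCycle v (hlab.corner 0) := by
  classical
  constructor
  · intro h
    let g : Q.emb.Face → ℤ := fun F =>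
      if hlab.succ.SameCycle ((hlab.slotEquiv 0).symm F) (hlab.corner 0) then 1 else 0
    have h0 : ∀ u, (hlab.slotEquiv 0).symm (hlab.slot 0 u) = u :=
      (hlab.slotEquiv 0).symm_apply_apply
    have hg := hlab.slot_eq_outer_of_reaches (h := g) (fun u => ?_) v h
    · simp only [g, h0] at hg
      change _ = if hlab.succ.SameCycle (hlab.corner 0) (hlab.corner 0) then (1 : ℤ) else 0 at hg
      rw [if_pos (Equiv.Perm.SameCycle.refl _ _)] at hg
      by_contra hc
      rw [if_neg hc] at hg
      exact zero_ne_one hg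
    · obtain ⟨u', rfl⟩ := hlab.succ.surjective u
      simp only [g, h0, slot_one_succ, Equiv.Perm.sameCycle_apply_left]
  · intro h
    have hsucc : ∀ u : Q.Inner, Q.Reaches lab i u (Q.s i) →
        Q.Reaches lab i (hlab.succ u) (Q.s i) := by
      intro u hu
      have h1 := hlab.slot_one_succ u
      fin_cases i
      · exact (hlab.reaches_iff_of_slot_eq (i := 0) h1.symm).1 hu
      · exact (hlab.reaches_iff_of_slot_eq (i := 1) h1).2 hu
    obtain ⟨n, -, rfl⟩ := h.symm.exists_pow_eq'
    clear h
    induction n with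
    | zero => exact hlab.corner_reaches i 0
    | succ n ih => rw [pow_succ', Equiv.Perm.mul_apply]; exact hsucc _ ih

theorem sameCycle_corner (v : Q.Inner) : hlab.succ.SameCycle v (hlab.corner 0) := by
  let p : V → Prop := fun v => ∀ i, v ≠ Q.s i → v ≠ Q.s (1 - i) → Q.Reaches lab i v (Q.s i)
  have hp : ∀ v : Q.Inner, (∃ i, Q.Reaches lab i v (Q.s i)) → p v := by
    rintro v ⟨i, hi⟩ j - -
    rw [hlab.reaches_iff_sameCycle] at hi ⊢
    exact hi
  have hadj : ∀ d : Q.graph.Dart, p d.fst → p d.snd := by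
    intro d hd j h1 h2
    have hin : ∀ k, d.snd ≠ Q.s k := by
      intro k
      by_cases hk : k = j
      · rwa [hk]
      · rw [← ne_eq, Fin.ne_iff_eq_one_sub] at hk
        rwa [hk]
    refine hp ⟨d.snd, hin⟩ ?_ j h1 h2
    obtain ⟨i, hi | hi⟩ := hlab.mem_T_or_symm_mem_T d
    · exact ⟨i, (hlab.fst_reaches_iff_snd_reaches hi).1
        (hd i (hlab.fst_ne_s hi i) (hlab.fst_ne_s hi (1 - i)))⟩
    · refine ⟨i, (hlab.fst_reaches_iff_snd_reaches hi).2 ?_⟩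
      change Q.Reaches lab i d.fst (Q.s i)
      by_cases h3 : d.fst = Q.s i
      · rw [h3]; exact Relation.ReflTransGen.refl
      · refine hd i h3 fun h4 => ?_
        have := hlab.eq_of_snd_eq_s hi h4
        exact absurd this (by clear * -; revert i; decide)
  have hall : ∀ u v : V, Q.graph.Reachable u v → p u → p v := by
    rintro u v ⟨w⟩
    induction w with
    | nil => exact id
    | cons h w ih => exact fun hu => ih (hadj ⟨(_, _), h⟩ hu)
  have h0 : p (Q.s 0) := fun i h1 h2 => by
    fin_cases i
    · exact absurd rfl h1
    · exact absurd rfl h2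
  exact (hlab.reaches_iff_sameCycle 0 v).1
    (hall _ _ (Q.connected.preconnected _ _) h0 0 (v.2 _) (v.2 _))

include hlab in
theorem reaches_s {i : Fin 2} {v : V} (hv : v ≠ Q.s (1 - i)) : Q.Reaches lab i v (Q.s i) := by
  by_cases h : v = Q.s i
  · rw [h]; exact Relation.ReflTransGen.refl
  · have hin : ∀ k, v ≠ Q.s k := by
      intro k
      by_cases hk : k = i
      · rwa [hk]
      · rw [← ne_eq, Fin.ne_iff_eq_one_sub] at hk
        rwa [hk]
    exact (hlab.reaches_iff_sameCycle i ⟨v, hin⟩).2 (hlab.sameCycle_corner _)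

include hlab in
theorem reaches_antisymm {i : Fin 2} {v w : V} (h : Q.Reaches lab i v w)
    (h' : Q.Reaches lab i w v) : v = w := by
  by_cases hv : v = Q.s (1 - i)
  · subst hv
    exact (hlab.reaches_s_iff.1 h).symm
  · exact hlab.reaches_antisymm' (hlab.reaches_s hv) h h'

/-- The position of an inner vertex on the equatorial line. -/
noncomputable def index (v : Q.Inner) : ℕ := sInf {k | (hlab.succ ^ k) (hlab.corner 1) = v}

theorem succ_pow_index (v : Q.Inner) : (hlab.succ ^ hlab.index v) (hlab.corner 1) = v := by
  have h : hlab.succ.SameCycle (hlab.corner 1) v :=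
    (hlab.sameCycle_corner _).trans (hlab.sameCycle_corner v).symm
  obtain ⟨n, -, hn⟩ := h.exists_pow_eq'
  exact Nat.sInf_mem (s := {k | (hlab.succ ^ k) (hlab.corner 1) = v}) ⟨n, hn⟩

theorem index_le_of_pow {v : Q.Inner} {k : ℕ} (h : (hlab.succ ^ k) (hlab.corner 1) = v) :
    hlab.index v ≤ k :=
  Nat.sInf_le h

theorem index_injective : Function.Injective hlab.index := by
  intro u v h
  rw [← hlab.succ_pow_index u, h, succ_pow_index]

theorem index_corner_one : hlab.index (hlab.corner 1) = 0 :=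
  Nat.le_zero.1 (hlab.index_le_of_pow rfl)

theorem index_succ {v : Q.Inner} (hv : v ≠ hlab.corner 0) :
    hlab.index (hlab.succ v) = hlab.index v + 1 := by
  apply le_antisymm
  · apply hlab.index_le_of_pow
    rw [pow_succ', Equiv.Perm.mul_apply, succ_pow_index]
  · have h := hlab.succ_pow_index (hlab.succ v)
    rcases hk : hlab.index (hlab.succ v) with _ | k
    · rw [hk, pow_zero, Equiv.Perm.one_apply, ← succ_corner] at h
      exact absurd (hlab.succ.injective h).symm hv
    · rw [hk, pow_succ', Equiv.Perm.mul_apply] at h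
      exact Nat.succ_le_succ (hlab.index_le_of_pow (hlab.succ.injective h))

theorem exists_succ_eq {v : Q.Inner} (hv : v ≠ hlab.corner 1) :
    ∃ u, u ≠ hlab.corner 0 ∧ hlab.succ u = v ∧ hlab.index v = hlab.index u + 1 := by
  obtain ⟨u, rfl⟩ := hlab.succ.surjective v
  have hu : u ≠ hlab.corner 0 := by
    rintro rfl
    exact hv hlab.succ_corner
  exact ⟨u, hu, rfl, hlab.index_succ hu⟩

theorem index_lt_card (v : Q.Inner) : hlab.index v < Nat.card Q.Inner := by
  have hinj : Function.Injective
      fun k : Fin (hlab.index v + 1) => (hlab.succ ^ (k : ℕ)) (hlab.corner 1) := by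
    have : ∀ j k : ℕ, j < k → k ≤ hlab.index v →
        (hlab.succ ^ j) (hlab.corner 1) ≠ (hlab.succ ^ k) (hlab.corner 1) := by
      intro j k hjk hk h
      have h1 : (hlab.succ ^ (hlab.index v - k + j)) (hlab.corner 1) = v := by
        rw [pow_add, Equiv.Perm.mul_apply, h, ← Equiv.Perm.mul_apply, ← pow_add,
          Nat.sub_add_cancel hk, succ_pow_index]
      have := hlab.index_le_of_pow h1
      omega
    intro j k h
    rcases lt_trichotomy j k with hjk | hjk | hjk
    · exact absurd h (this _ _ hjk (by omega))
    · exact hjk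
    · exact absurd h.symm (this _ _ hjk (by omega))
  have := Nat.card_le_card_of_injective _ hinj
  rw [Nat.card_fin] at this
  exact this

theorem exists_index_eq {k : ℕ} (hk : k < Nat.card Q.Inner) : ∃ v, hlab.index v = k := by
  have hinj : Function.Injective fun v =>
      (⟨hlab.index v, hlab.index_lt_card v⟩ : Fin (Nat.card Q.Inner)) :=
    fun u v h => hlab.index_injective (Fin.mk.inj_iff.1 h)
  obtain ⟨v, hv⟩ := (hinj.bijective_of_nat_card_le (by rw [Nat.card_fin])).2 ⟨k, hk⟩
  exact ⟨v, Fin.mk.inj_iff.1 hv⟩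

theorem index_corner_zero : hlab.index (hlab.corner 0) + 1 = Nat.card Q.Inner := by
  have h0 := hlab.index_lt_card (hlab.corner 0)
  obtain ⟨v, hv⟩ := hlab.exists_index_eq (k := Nat.card Q.Inner - 1) (by omega)
  by_cases h : v = hlab.corner 0
  · rw [← h]; omega
  · have := hlab.index_lt_card (hlab.succ v)
    rw [hlab.index_succ h] at this
    omega

theorem index_le_corner_zero (v : Q.Inner) : hlab.index v ≤ hlab.index (hlab.corner 0) := by
  have := hlab.index_lt_card v
  have := hlab.index_corner_zero
  omega

open Classical in
/-- The side of the inner vertex `v` on which the equatorial line passes through a face: `0` if it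
does so before `v` (or if the face is the outer one), and `1` otherwise. -/
noncomputable def side (v : Q.Inner) (F : Q.emb.Face) : ℤ :=
  if F ≠ Q.outer ∧ hlab.index v ≤ hlab.index ((hlab.slotEquiv 0).symm F) then 1 else 0

theorem slot_eq_outer_iff {j : Fin 2} {u : Q.Inner} :
    hlab.slot j u = Q.outer ↔ u = hlab.corner j := by
  rw [← hlab.slot_corner j, (hlab.slot_injective j).eq_iff]

theorem side_outer (v : Q.Inner) : hlab.side v Q.outer = 0 := by
  simp [side]

open Classical in
theorem side_slot_zero (v u : Q.Inner) : hlab.side v (hlab.slot 0 u) =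
    if u ≠ hlab.corner 0 ∧ hlab.index v ≤ hlab.index u then 1 else 0 := by
  have : (hlab.slotEquiv 0).symm (hlab.slot 0 u) = u := (hlab.slotEquiv 0).symm_apply_apply u
  simp only [side, this, ne_eq, slot_eq_outer_iff]

theorem side_slot_one (v u : Q.Inner) : hlab.side v (hlab.slot 1 u) =
    if hlab.index v < hlab.index u then 1 else 0 := by
  by_cases hu : u = hlab.corner 1
  · rw [hu, slot_corner, side_outer, index_corner_one, if_neg (Nat.not_lt_zero _)]
  · obtain ⟨w, hw, rfl, hi⟩ := hlab.exists_succ_eq hu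
    rw [slot_one_succ, side_slot_zero, hi]
    simp [hw]

theorem side_eq_zero_or_one (v : Q.Inner) (F : Q.emb.Face) :
    hlab.side v F = 0 ∨ hlab.side v F = 1 := by
  rw [side]; split_ifs <;> simp

theorem side_anti {v w : Q.Inner} (h : hlab.index v ≤ hlab.index w) (F : Q.emb.Face) :
    hlab.side w F ≤ hlab.side v F := by
  rw [side, side]
  split_ifs with h1 h2 h2
  · exact le_rfl
  · exact absurd ⟨h1.1, h.trans h1.2⟩ h2
  · exact zero_le_one
  · exact le_rfl

open Classical in
theorem side_slot_sub (v u : Q.Inner) :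
    hlab.side v (hlab.slot 0 u) - hlab.side v (hlab.slot 1 u) =
      (if v = u then 1 else 0) - if hlab.corner 0 = u then 1 else 0 := by
  rw [side_slot_zero, side_slot_one]
  have h1 := hlab.index_le_corner_zero v
  have h2 : v = u ↔ hlab.index v = hlab.index u := hlab.index_injective.eq_iff.symm
  by_cases h3 : u = hlab.corner 0
  · subst h3
    simp only [h2, ne_eq, not_true_eq_false, false_and, if_false, if_true]
    split_ifs <;> omega
  · have h4 : ¬ hlab.corner 0 = u := fun h => h3 h.symm
    simp only [h2, h4, ne_eq, h3, not_false_eq_true, true_and, if_false]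
    split_ifs <;> omega

open Classical in
include hlab in
theorem ite_reaches (i : Fin 2) (v a : V) : (if Q.Reaches lab i v a then 1 else 0 : ℤ) =
    (if v = a then 1 else 0) +
      ∑ e ∈ Q.inDarts lab i a, if Q.Reaches lab i v e.fst then 1 else 0 := by
  by_cases hva : v = a
  · subst hva
    rw [if_pos (Reaches.refl v), if_pos rfl, Finset.sum_eq_zero, add_zero]
    intro e he
    rw [mem_inDarts] at he
    refine if_neg fun h => e.adj.ne ?_
    rw [he.2]
    exact hlab.reaches_antisymm (he.2 ▸ Reaches.of_mem_T he.1) h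
  · rw [if_neg hva, zero_add]
    by_cases h : Q.Reaches lab i v a
    · rw [if_pos h]
      rcases Relation.ReflTransGen.cases_tail h with h | ⟨_, hv, e, he, rfl, rfl⟩
      · exact absurd h.symm hva
      · rw [Finset.sum_eq_single e, if_pos (show Q.Reaches lab i v e.fst from hv)]
        · intro e' he' hne
          rw [mem_inDarts] at he'
          have key : ∀ e e' : Q.graph.Dart, e ∈ Q.T lab i → e' ∈ Q.T lab i → e.snd = e'.snd →
              Q.Reaches lab i e.fst e'.fst → e = e' := by
            intro e e' he he' hs h
            rcases (hlab.reaches_fst_iff he).1 h with h | h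
            · exact hlab.T_unique he he' h
            · rw [hs] at h
              exact absurd (hlab.reaches_antisymm (Reaches.of_mem_T he') h) e'.adj.ne
          refine if_neg fun h' => hne ?_
          rcases hlab.reaches_total hv h' with h'' | h''
          · exact (key e e' he he'.1 he'.2.symm h'').symm
          · exact key e' e he'.1 he he'.2 h''
        · intro hn
          exact absurd (mem_inDarts.2 ⟨he, rfl⟩) hn
    · rw [if_neg h, Finset.sum_eq_zero]
      intro e he
      rw [mem_inDarts] at he
      exact if_neg fun h' => h (h'.trans (he.2 ▸ Reaches.of_mem_T he.1))

theorem corner_reaches_iff {i j : Fin 2} {a : Q.Inner} :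
    Q.Reaches lab i (hlab.corner j) a ↔ hlab.corner j = a := by
  have hs : ¬ Q.Reaches lab i (Q.s i) a := fun h => a.2 i (hlab.reaches_s_iff.1 h)
  obtain ⟨-, ⟨e, he, h1, h2, -⟩, ⟨e', he', h1', h2', -⟩⟩ := hlab.corner_spec j
  rw [← Subtype.coe_inj]
  by_cases h : i = j
  · subst h
    rw [← h1, hlab.reaches_fst_iff he, h2, or_iff_left hs]
  · rw [← ne_eq, Fin.ne_iff_eq_one_sub] at h
    subst h
    rw [← h1', hlab.reaches_fst_iff he', h2', or_iff_left hs]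

variable (Q) in
/-- The face on the side of an edge of colour `i` that comes later on the equatorial line. -/
def upper (i : Fin 2) (d : Q.graph.Dart) : Q.emb.Face :=
  if i = 0 then Q.emb.left d else Q.emb.right d

variable (Q) in
/-- The face on the side of an edge of colour `i` that comes earlier on the equatorial line. -/
def lower (i : Fin 2) (d : Q.graph.Dart) : Q.emb.Face :=
  if i = 0 then Q.emb.right d else Q.emb.left d

open Classical in
/-- The inner vertices from which a path of `T i` uses the edge `d` are those between the two
faces at `d` on the equatorial line. -/
theorem side_upper_sub_side_lower (v : Q.Inner) {i : Fin 2} {d : Q.graph.Dart}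
    (hd : d ∈ Q.T lab i) : hlab.side v (upper Q i d) - hlab.side v (lower Q i d) =
      (if Q.Reaches lab i v d.fst then 1 else 0) -
        if Q.Reaches lab i (hlab.corner 0) d.fst then 1 else 0 := by
  have hs := hlab.reaches_s (i := i) (v := d.fst) (hlab.fst_ne_s hd _)
  have h := hlab.eq_zero_of_eq_sum (i := i) (fun d =>
    (if i = 0 then (1 : ℤ) else -1) * (hlab.side v (Q.emb.left d) - hlab.side v (Q.emb.right d)) -
      ((if Q.Reaches lab i v d.fst then 1 else 0) -
        if Q.Reaches lab i (hlab.corner 0) d.fst then 1 else 0)) (fun d hd => ?_) hd hs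
  · rw [upper, lower]
    rcases Fin.exists_fin_two.1 ⟨i, rfl⟩ with rfl | rfl
    · simp only [if_true] at h ⊢
      linarith
    · simp only [one_ne_zero, if_false] at h ⊢
      linarith
  · have h1 := hlab.left_sub_right (v := ⟨d.fst, hlab.fst_ne_s hd⟩) hd rfl (hlab.side v)
    have h2 := hlab.side_slot_sub v ⟨d.fst, hlab.fst_ne_s hd⟩
    rw [h1, hlab.ite_reaches i v d.fst, hlab.ite_reaches i (hlab.corner 0) d.fst,
      Finset.sum_sub_distrib]
    simp only [Finset.sum_sub_distrib, ← Finset.mul_sum]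
    simp only [Subtype.ext_iff] at h2
    rcases Fin.exists_fin_two.1 ⟨i, rfl⟩ with rfl | rfl
    · simp only [if_true, sub_zero, one_mul]
      linarith
    · simp only [one_ne_zero, if_false, sub_self]
      linarith

theorem upper_eq_outer {i : Fin 2} {d : Q.graph.Dart} (hd : d ∈ Q.T lab i)
    (h : d.fst = hlab.corner 0) : upper Q i d = Q.outer := by
  obtain ⟨-, ⟨e, he, h1, h2, h3⟩, ⟨e', he', h1', h2', h3'⟩⟩ := hlab.corner_spec 0
  rw [upper]
  rcases Fin.exists_fin_two.1 ⟨i, rfl⟩ with rfl | rfl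
  · rw [hlab.T_unique hd he (h.trans h1.symm), if_pos rfl, h3]
  · rw [hlab.T_unique hd he' (h.trans h1'.symm), if_neg one_ne_zero, h3']

theorem side_of_reaches {v : Q.Inner} {i : Fin 2} {d : Q.graph.Dart} (hd : d ∈ Q.T lab i)
    (h : Q.Reaches lab i v d.fst) : hlab.side v (lower Q i d) = 0 ∧
      (hlab.side v (upper Q i d) = 1 ∨ d.fst = hlab.corner 0) := by
  have h1 := hlab.side_upper_sub_side_lower v hd
  have h2 := hlab.corner_reaches_iff (i := i) (j := 0) (a := ⟨d.fst, hlab.fst_ne_s hd⟩)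
  rw [Subtype.ext_iff] at h2
  simp only at h2
  rw [if_pos h, h2] at h1
  have h3 := hlab.side_eq_zero_or_one v (lower Q i d)
  have h4 := hlab.side_eq_zero_or_one v (upper Q i d)
  by_cases h5 : (hlab.corner 0 : V) = d.fst
  · rw [if_pos h5, hlab.upper_eq_outer hd h5.symm, side_outer] at h1
    exact ⟨by omega, Or.inr h5.symm⟩
  · rw [if_neg h5] at h1
    omega

theorem side_of_not_reaches {v : Q.Inner} {i : Fin 2} {d : Q.graph.Dart} (hd : d ∈ Q.T lab i)
    (h : ¬ Q.Reaches lab i v d.fst) (hu : upper Q i d ≠ Q.outer) :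
    hlab.side v (upper Q i d) = hlab.side v (lower Q i d) := by
  have h1 := hlab.side_upper_sub_side_lower v hd
  have h2 := hlab.corner_reaches_iff (i := i) (j := 0) (a := ⟨d.fst, hlab.fst_ne_s hd⟩)
  rw [Subtype.ext_iff] at h2
  simp only at h2
  rw [if_neg h, h2, if_neg] at h1
  · linarith
  · exact fun h' => hu (hlab.upper_eq_outer hd h'.symm)

include hlab in
theorem reaches_of_side {v : Q.Inner} {i : Fin 2} {d : Q.graph.Dart} (hd : d ∈ Q.T lab i)
    (hl : hlab.side v (lower Q i d) = 0)
    (hu : hlab.side v (upper Q i d) = 1 ∨ d.fst = hlab.corner 0) : Q.Reaches lab i v d.fst := by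
  by_contra h
  rcases hu with hu | hu
  · have := hlab.side_of_not_reaches hd h (by
      intro h'
      rw [h', side_outer] at hu
      exact zero_ne_one hu)
    omega
  · have h1 := hlab.side_upper_sub_side_lower v hd
    rw [if_neg h, hl, hlab.upper_eq_outer hd hu, side_outer, hu,
      if_pos (Reaches.refl _)] at h1
    omega

include hlab in
theorem reaches_of_index_mem_Icc {i : Fin 2} {u v w a : Q.Inner} (hu : Q.Reaches lab i u a)
    (hv : Q.Reaches lab i v a) (huw : hlab.index u ≤ hlab.index w)
    (hwv : hlab.index w ≤ hlab.index v) : Q.Reaches lab i w a := by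
  obtain ⟨d, hd, hda⟩ := hlab.exists_mem_T i a
  rw [← hda] at hu hv ⊢
  obtain ⟨h1, -⟩ := hlab.side_of_reaches hd hu
  obtain ⟨-, h2⟩ := hlab.side_of_reaches hd hv
  refine hlab.reaches_of_side hd ?_ (h2.imp_left fun h2 => ?_)
  · have := hlab.side_anti huw (lower Q i d)
    have := hlab.side_eq_zero_or_one w (lower Q i d)
    omega
  · have := hlab.side_anti hwv (upper Q i d)
    have := hlab.side_eq_zero_or_one w (upper Q i d)
    omega

theorem index_le_of_reaches {i : Fin 2} {v a : Q.Inner} (h : Q.Reaches lab i v a)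
    (ha : (a : V) ∈ Q.black ↔ i = 0) : hlab.index a ≤ hlab.index v := by
  obtain ⟨d, hd, hda⟩ := hlab.exists_mem_T i a
  have hl : lower Q i d = hlab.slot 1 a := by
    rw [lower]
    rcases Fin.exists_fin_two.1 ⟨i, rfl⟩ with rfl | rfl
    · rw [if_pos rfl, ← hlab.slot_of_mem_black hd hda (ha.2 rfl), sub_zero]
    · rw [if_neg one_ne_zero,
        hlab.slot_of_notMem_black hd hda (fun h => one_ne_zero (ha.1 h))]
  rw [← hda] at h
  have := (hlab.side_of_reaches hd h).1
  rw [hl, side_slot_one] at this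
  by_contra h'
  rw [if_pos (by omega)] at this
  exact one_ne_zero this

theorem le_index_of_reaches {i : Fin 2} {v a : Q.Inner} (h : Q.Reaches lab i v a)
    (ha : ¬ ((a : V) ∈ Q.black ↔ i = 0)) : hlab.index v ≤ hlab.index a := by
  obtain ⟨d, hd, hda⟩ := hlab.exists_mem_T i a
  have hl : upper Q i d = hlab.slot 0 a := by
    rw [upper]
    rcases Fin.exists_fin_two.1 ⟨i, rfl⟩ with rfl | rfl
    · rw [if_pos rfl, hlab.slot_of_notMem_black hd hda (by tauto)]
    · rw [if_neg one_ne_zero, ← hlab.slot_of_mem_black hd hda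
        (by have : (1 : Fin 2) ≠ 0 := one_ne_zero; tauto), sub_self]
  rw [← hda] at h
  rcases (hlab.side_of_reaches hd h).2 with h1 | h1
  · rw [hl, side_slot_zero] at h1
    by_contra h'
    rw [if_neg (fun h2 => h' h2.2)] at h1
    exact zero_ne_one h1
  · rw [Subtype.ext (hda.symm.trans h1)]
    exact hlab.index_le_corner_zero v

include hlab in
theorem mem_P_iff {i : Fin 2} {v : Q.Inner} {d : Q.graph.Dart} :
    d ∈ Q.P lab i v ↔ d ∈ Q.T lab i ∧ Q.Reaches lab i v d.fst := by
  constructor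
  · exact fun h => ⟨h.1, h.2.1⟩
  · refine fun h => ⟨h.1, h.2, hlab.reaches_s fun h' => ?_⟩
    exact absurd (hlab.eq_of_snd_eq_s h.1 h') (by clear * -; revert i; decide)

theorem side_of_mem_P {i : Fin 2} {v : Q.Inner} {d : Q.graph.Dart} (hd : d ∈ Q.P lab i v) :
    (Q.emb.right d ≠ Q.outer → hlab.side v (Q.emb.right d) = (i : ℕ)) ∧
      (Q.emb.left d ≠ Q.outer → hlab.side v (Q.emb.left d) = ((1 - i : Fin 2) : ℕ)) := by
  rw [hlab.mem_P_iff] at hd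
  obtain ⟨h1, h2⟩ := hlab.side_of_reaches hd.1 hd.2
  have h2 : upper Q i d ≠ Q.outer → hlab.side v (upper Q i d) = 1 :=
    fun h => h2.resolve_right fun h' => h (hlab.upper_eq_outer hd.1 h')
  rw [upper] at h2
  rw [lower] at h1
  rcases Fin.exists_fin_two.1 ⟨i, rfl⟩ with rfl | rfl
  · exact ⟨fun _ => h1, h2⟩
  · exact ⟨h2, fun _ => h1⟩

theorem side_eq_of_adjOff {v : Q.Inner} {A B : Q.emb.Face} (h : Q.AdjOff lab v A B) :
    hlab.side v A = hlab.side v B := by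
  obtain ⟨hA, hB, d, rfl, rfl, hd⟩ := h
  have key : ∀ i, ∀ e ∈ Q.T lab i, e ∉ Q.P lab i v → Q.emb.right e ≠ Q.outer →
      Q.emb.left e ≠ Q.outer → hlab.side v (Q.emb.right e) = hlab.side v (Q.emb.left e) := by
    intro i e he heP hr hl
    have h := hlab.side_of_not_reaches (v := v) he (fun h => heP (hlab.mem_P_iff.2 ⟨he, h⟩))
    rw [upper, lower] at h
    rcases Fin.exists_fin_two.1 ⟨i, rfl⟩ with rfl | rfl
    · exact (h hl).symm
    · exact h hr
  obtain ⟨i, hi | hi⟩ := hlab.mem_T_or_symm_mem_T d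
  · exact key i d hi (hd i).1 hA hB
  · have := key i d.symm hi (hd i).2 hB (by rwa [Q.emb.left_symm])
    rw [Q.emb.left_symm, Q.emb.right_symm] at this
    exact this.symm

theorem side_of_mem_R {i : Fin 2} {v : Q.Inner} {F : Q.emb.Face} (hF : F ∈ Q.R lab i v) :
    F ≠ Q.outer ∧ hlab.side v F = (i : ℕ) := by
  obtain ⟨A, hA, hP, hAF⟩ := hF
  have h1 : hlab.side v A = (i : ℕ) := by
    rcases hP with ⟨d, hd, rfl⟩ | ⟨d, hd, rfl⟩
    · exact (hlab.side_of_mem_P hd).1 hA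
    · have := (hlab.side_of_mem_P hd).2 hA
      rwa [Fin.one_sub_one_sub] at this
  have hAF' : Relation.ReflTransGen (Q.AdjOff lab v) A F := hAF
  induction hAF' with
  | refl => exact ⟨hA, h1⟩
  | tail hAB hBC ih =>
    exact ⟨hBC.2.1, (hlab.side_eq_of_adjOff hBC).symm.trans (ih hAB).2⟩

omit [Finite V] in
theorem left_mem_R {v : V} {d : Q.graph.Dart} (hd : ∃ i, Q.emb.right d ∈ Q.R lab i v)
    (hr : Q.emb.right d ≠ Q.outer) (hl : Q.emb.left d ≠ Q.outer) :
    ∃ i, Q.emb.left d ∈ Q.R lab i v := by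
  by_cases h : ∃ j, d ∈ Q.P lab j v ∨ d.symm ∈ Q.P lab j v
  · obtain ⟨j, h | h⟩ := h
    · exact ⟨1 - j, _, hl, Or.inr ⟨d, by rwa [Fin.one_sub_one_sub], rfl⟩,
        Relation.ReflTransGen.refl⟩
    · exact ⟨j, _, hl, Or.inl ⟨d.symm, h, rfl⟩, Relation.ReflTransGen.refl⟩
  · push Not at h
    obtain ⟨i, A, hA, hP, hAF⟩ := hd
    exact ⟨i, A, hA, hP, hAF.tail ⟨hr, hl, d, rfl, rfl, h⟩⟩

theorem slot_eq_right_of_fst (j : Fin 2) (u : Q.Inner) :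
    ∃ d : Q.graph.Dart, d.fst = u ∧ hlab.slot j u = Q.emb.right d := by
  by_cases hb : (u : V) ∈ Q.black
  · exact ⟨_, hlab.turn_fst j u, by rw [slot, if_pos hb]⟩
  · exact ⟨Q.emb.rot (hlab.turn j u), (Q.emb.rot_fst _).trans (hlab.turn_fst j u),
      by rw [slot, if_neg hb, Q.emb.right_rot]⟩

include hlab in
theorem right_mem_R {v : V} {u : Q.Inner} (hu : ∀ j, u ≠ hlab.corner j) {d e : Q.graph.Dart}
    (hd : d.fst = u) (he : e.fst = u) (h : ∃ i, Q.emb.right d ∈ Q.R lab i v) :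
    ∃ i, Q.emb.right e ∈ Q.R lab i v := by
  have hout : ∀ c : Q.graph.Dart, c.fst = u → Q.emb.right c ≠ Q.outer := by
    intro c hc hco
    obtain ⟨j, hj | hj⟩ := hlab.eq_of_right_eq_outer hco
    · exact u.2 j (hc.symm.trans hj)
    · exact hu j (Subtype.ext (hc.symm.trans hj))
  obtain ⟨n, -, rfl⟩ := (Q.emb.rot_cyclic d e (hd.trans he.symm)).exists_pow_eq'
  clear he
  suffices ((Q.emb.rot ^ n) d).fst = u ∧ ∃ i, Q.emb.right ((Q.emb.rot ^ n) d) ∈ Q.R lab i v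
    from this.2
  induction n with
  | zero => exact ⟨hd, h⟩
  | succ n ih =>
    rw [pow_succ', Equiv.Perm.mul_apply]
    have h1 := (Q.emb.rot_fst _).trans ih.1
    have h2 := hout _ h1
    rw [Q.emb.right_rot] at h2 ⊢
    exact ⟨h1, left_mem_R ih.2 (hout _ ih.1) h2⟩

theorem slot_mem_R_iff {v : V} {u : Q.Inner} (hu : ∀ j, u ≠ hlab.corner j) :
    (∃ i, hlab.slot 0 u ∈ Q.R lab i v) ↔ ∃ i, hlab.slot 1 u ∈ Q.R lab i v := by
  obtain ⟨d, hd, h0⟩ := hlab.slot_eq_right_of_fst 0 u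
  obtain ⟨e, he, h1⟩ := hlab.slot_eq_right_of_fst 1 u
  rw [h0, h1]
  exact ⟨hlab.right_mem_R hu hd he, hlab.right_mem_R hu he hd⟩

theorem slot_mem_R_iff_corner {v : V} {u : Q.Inner} (hu : u ≠ hlab.corner 0) :
    (∃ i, hlab.slot 0 u ∈ Q.R lab i v) ↔ ∃ i, hlab.slot 0 (hlab.corner 1) ∈ Q.R lab i v := by
  induction hk : hlab.index u generalizing u with
  | zero =>
    rw [← hlab.index_corner_one] at hk
    rw [hlab.index_injective hk]
  | succ k ih =>
    have hu1 : u ≠ hlab.corner 1 := by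
      rintro rfl
      rw [index_corner_one] at hk
      omega
    obtain ⟨w, hw, rfl, hi⟩ := hlab.exists_succ_eq hu1
    rw [← ih hw (by omega), ← hlab.slot_one_succ w]
    refine hlab.slot_mem_R_iff fun j => ?_
    rcases Fin.exists_fin_two.1 ⟨j, rfl⟩ with rfl | rfl
    · exact hu
    · exact hu1

theorem slot_mem_R_self (j : Fin 2) {v : Q.Inner} (hv : hlab.slot j v ≠ Q.outer) :
    ∃ i, hlab.slot j v ∈ Q.R lab i v := by
  by_cases hb : (v : V) ∈ Q.black
  · obtain ⟨d, hd, hdv⟩ := hlab.exists_mem_T (1 - j) v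
    have h := hlab.slot_of_mem_black hd hdv hb
    rw [Fin.one_sub_one_sub] at h
    refine ⟨1 - j, _, hv, Or.inl ⟨d, hlab.mem_P_iff.2 ⟨hd, hdv ▸ Reaches.refl _⟩, h.symm⟩,
      Relation.ReflTransGen.refl⟩
  · obtain ⟨d, hd, hdv⟩ := hlab.exists_mem_T j v
    refine ⟨1 - j, _, hv, Or.inr ⟨d, ?_, (hlab.slot_of_notMem_black hd hdv hb).symm⟩,
      Relation.ReflTransGen.refl⟩
    rw [Fin.one_sub_one_sub]
    exact hlab.mem_P_iff.2 ⟨hd, hdv ▸ Reaches.refl _⟩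

include hlab in
/-- The two regions of a vertex contain all bounded faces. -/
theorem exists_mem_R (v : Q.Inner) {F : Q.emb.Face} (hF : F ≠ Q.outer) :
    ∃ i, F ∈ Q.R lab i v := by
  obtain ⟨u, rfl⟩ := hlab.slot_surjective 0 F
  have hu : u ≠ hlab.corner 0 := fun h => hF (hlab.slot_eq_outer_iff.2 h)
  rw [hlab.slot_mem_R_iff_corner hu]
  by_cases hv : v = hlab.corner 0
  · have hv1 : v ≠ hlab.corner 1 := by
      intro h
      have h1 := hlab.index_le_corner_zero u
      rw [← hv, h, index_corner_one, Nat.le_zero, ← hlab.index_corner_one] at h1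
      exact hu ((hlab.index_injective h1).trans (h.symm.trans hv))
    have h1 := hlab.slot_mem_R_self 1 (fun h => hv1 (hlab.slot_eq_outer_iff.1 h))
    obtain ⟨w, hw, rfl, -⟩ := hlab.exists_succ_eq hv1
    rwa [slot_one_succ, hlab.slot_mem_R_iff_corner hw] at h1
  · have h0 := hlab.slot_mem_R_self 0 (fun h => hv (hlab.slot_eq_outer_iff.1 h))
    rwa [hlab.slot_mem_R_iff_corner hv] at h0

theorem mem_R_iff {i : Fin 2} {v : Q.Inner} {F : Q.emb.Face} :
    F ∈ Q.R lab i v ↔ F ≠ Q.outer ∧ hlab.side v F = (i : ℕ) := by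
  refine ⟨hlab.side_of_mem_R, fun h => ?_⟩
  obtain ⟨j, hj⟩ := hlab.exists_mem_R v h.1
  have := (hlab.side_of_mem_R hj).2
  rw [h.2, Nat.cast_inj, Fin.val_inj] at this
  rwa [this]

theorem ncard_index_mem {s : Set ℕ} (hs : ∀ k ∈ s, k < Nat.card Q.Inner) :
    {u | hlab.index u ∈ s}.ncard = s.ncard := by
  rw [← hlab.index_injective.injOn.ncard_image]
  congr 1
  ext k
  constructor
  · rintro ⟨u, hu, rfl⟩
    exact hu
  · intro hk
    obtain ⟨u, rfl⟩ := hlab.exists_index_eq (hs k hk)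
    exact ⟨u, hk, rfl⟩

theorem index_lt_iff (u : Q.Inner) : u ≠ hlab.corner 0 ↔ hlab.index u + 1 < Nat.card Q.Inner := by
  have h1 := hlab.index_corner_zero
  have h2 := hlab.index_le_corner_zero u
  rw [← hlab.index_injective.ne_iff]
  omega

theorem ncard_R_zero (v : Q.Inner) : (Q.R lab 0 v).ncard = hlab.index v := by
  have hR : Q.R lab 0 v = hlab.slot 0 '' {u | hlab.index u ∈ Set.Iio (hlab.index v)} := by
    ext F
    obtain ⟨u, rfl⟩ := hlab.slot_surjective 0 F
    rw [(hlab.slot_injective 0).mem_set_image, hlab.mem_R_iff, side_slot_zero, ne_eq,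
      slot_eq_outer_iff]
    have h1 := hlab.index_lt_iff u
    have h2 := hlab.index_lt_card v
    have h3 := hlab.index_lt_card u
    change _ ↔ hlab.index u < hlab.index v
    simp only [h1]
    split_ifs with h
    · simp; omega
    · simp; omega
  rw [hR, ((hlab.slot_injective 0).injOn).ncard_image, ncard_index_mem, ← Finset.coe_Iio,
    Set.ncard_coe_finset, Nat.card_Iio]
  exact fun k hk => lt_trans hk (hlab.index_lt_card v)

theorem ncard_R_one (v : Q.Inner) :
    (Q.R lab 1 v).ncard = Nat.card Q.Inner - 1 - hlab.index v := by
  have hR : Q.R lab 1 v = hlab.slot 0 ''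
      {u | hlab.index u ∈ Set.Ico (hlab.index v) (Nat.card Q.Inner - 1)} := by
    ext F
    obtain ⟨u, rfl⟩ := hlab.slot_surjective 0 F
    rw [(hlab.slot_injective 0).mem_set_image, hlab.mem_R_iff, side_slot_zero, ne_eq,
      slot_eq_outer_iff]
    have h1 := hlab.index_lt_iff u
    have h2 := hlab.index_lt_card v
    have h3 := hlab.index_lt_card u
    change _ ↔ hlab.index v ≤ hlab.index u ∧ hlab.index u < Nat.card Q.Inner - 1
    simp only [h1]
    split_ifs with h
    · simp; omega
    · simp; omega
  rw [hR, ((hlab.slot_injective 0).injOn).ncard_image, ncard_index_mem, ← Finset.coe_Ico,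
    Set.ncard_coe_finset, Nat.card_Ico]
  intro k hk
  have := hk.2
  omega

omit [Finite V] in
variable (Q) in
theorem eq_s_or_inner (v : V) : v = Q.s 0 ∨ v = Q.s 1 ∨ ∃ u : Q.Inner, v = u := by
  by_cases h0 : v = Q.s 0
  · exact Or.inl h0
  · by_cases h1 : v = Q.s 1
    · exact Or.inr (Or.inl h1)
    · exact Or.inr (Or.inr ⟨⟨v, Fin.forall_fin_two.2 ⟨h0, h1⟩⟩, rfl⟩)

variable (Q) in
theorem card_eq : Nat.card V = Nat.card Q.Inner + 2 := by
  have h1 : Set.ncard {v | ∀ i, v ≠ Q.s i} = Nat.card Q.Inner := rfl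
  have h2 : {v | ∀ i, v ≠ Q.s i} = ({Q.s 0, Q.s 1} : Set V)ᶜ := by
    ext v
    simp [Fin.forall_fin_two]
  have h3 := Set.ncard_add_ncard_compl ({Q.s 0, Q.s 1} : Set V)
  rw [Set.ncard_pair Q.s_ne, ← h2, h1] at h3
  omega

theorem f_zero_coe (v : Q.Inner) : Q.f lab 0 v = hlab.index v := by
  rw [f, if_neg (v.2 _), if_neg (v.2 _), hlab.ncard_R_zero]

theorem f_one_coe (v : Q.Inner) : Q.f lab 1 v = Nat.card V - 3 - hlab.index v := by
  rw [f, if_neg (v.2 _), if_neg (v.2 _), hlab.ncard_R_one]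
  have := card_eq Q
  have := hlab.index_lt_card v
  omega

omit [Finite V] in
variable (Q lab) in
theorem f_s_zero : Q.f lab 0 (Q.s 0) = -1 ∧ Q.f lab 1 (Q.s 0) = Nat.card V - 2 := by
  rw [f, f, if_pos rfl, if_neg Q.s_ne, sub_self, if_pos rfl]
  exact ⟨rfl, rfl⟩

omit [Finite V] in
variable (Q lab) in
theorem f_s_one : Q.f lab 0 (Q.s 1) = Nat.card V - 2 ∧ Q.f lab 1 (Q.s 1) = -1 := by
  rw [f, f, if_pos rfl, if_neg Q.s_ne.symm, sub_zero, if_pos rfl]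
  exact ⟨rfl, rfl⟩

include hlab in
theorem f_add_f (v : V) : Q.f lab 0 v + Q.f lab 1 v = Nat.card V - 3 := by
  rcases eq_s_or_inner Q v with rfl | rfl | ⟨u, rfl⟩
  · rw [(f_s_zero Q lab).1, (f_s_zero Q lab).2]; ring
  · rw [(f_s_one Q lab).1, (f_s_one Q lab).2]; ring
  · rw [hlab.f_zero_coe, hlab.f_one_coe]; ring

include hlab in
theorem f_zero_bounds (u : Q.Inner) : 0 ≤ Q.f lab 0 u ∧ Q.f lab 0 u < Nat.card V - 2 := by
  have := card_eq Q
  have := hlab.index_lt_card u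
  rw [hlab.f_zero_coe]
  omega

include hlab in
theorem bijOn_f_zero :
    Set.BijOn (Q.f lab 0) Set.univ (Set.Icc (-1) ((Nat.card V : ℤ) - 2)) := by
  have h0 := (f_s_zero Q lab).1
  have h1 := (f_s_one Q lab).1
  have hc := card_eq Q
  refine ⟨?_, ?_, ?_⟩
  · intro v _
    rcases eq_s_or_inner Q v with rfl | rfl | ⟨u, rfl⟩
    · rw [h0, Set.mem_Icc]; omega
    · rw [h1, Set.mem_Icc]; omega
    · have := hlab.f_zero_bounds u
      rw [Set.mem_Icc]; omega
  · rintro v - w - h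
    rcases eq_s_or_inner Q v with rfl | rfl | ⟨u, rfl⟩ <;>
      rcases eq_s_or_inner Q w with rfl | rfl | ⟨u', rfl⟩
    · rfl
    · omega
    · have := hlab.f_zero_bounds u'; omega
    · omega
    · rfl
    · have := hlab.f_zero_bounds u'; omega
    · have := hlab.f_zero_bounds u; omega
    · have := hlab.f_zero_bounds u; omega
    · rw [hlab.f_zero_coe, hlab.f_zero_coe, Nat.cast_inj] at h
      rw [hlab.index_injective h]
  · rintro k ⟨hk, hk'⟩
    by_cases hk0 : k = -1
    · exact ⟨Q.s 0, trivial, h0.trans hk0.symm⟩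
    · by_cases hk1 : k = Nat.card V - 2
      · exact ⟨Q.s 1, trivial, h1.trans hk1.symm⟩
      · obtain ⟨u, hu⟩ := hlab.exists_index_eq (k := k.toNat) (by omega)
        refine ⟨u, trivial, ?_⟩
        rw [hlab.f_zero_coe, hu]
        omega

include hlab in
theorem f_zero_injective : Function.Injective (Q.f lab 0) :=
  Set.injOn_univ.1 hlab.bijOn_f_zero.injOn

include hlab in
theorem f_zero_mem_Icc (v : V) : -1 ≤ Q.f lab 0 v ∧ Q.f lab 0 v ≤ Nat.card V - 2 :=
  hlab.bijOn_f_zero.mapsTo (Set.mem_univ v)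

include hlab in
theorem f_one_eq (v : V) : Q.f lab 1 v = Nat.card V - 3 - Q.f lab 0 v := by
  have := hlab.f_add_f v
  omega

include hlab in
theorem bijOn_f (i : Fin 2) :
    Set.BijOn (Q.f lab i) Set.univ (Set.Icc (-1) ((Nat.card V : ℤ) - 2)) := by
  have h0 := hlab.bijOn_f_zero
  rcases Fin.exists_fin_two.1 ⟨i, rfl⟩ with rfl | rfl
  · exact h0
  · refine ⟨fun v _ => ?_, fun v _ w _ h => ?_, fun k hk => ?_⟩
    · have := hlab.f_zero_mem_Icc v
      rw [Set.mem_Icc, hlab.f_one_eq]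
      omega
    · rw [hlab.f_one_eq, hlab.f_one_eq] at h
      exact hlab.f_zero_injective (by omega)
    · rw [Set.mem_Icc] at hk
      obtain ⟨v, -, hv⟩ := h0.surjOn (a := Nat.card V - 3 - k) (Set.mem_Icc.2 (by omega))
      exact ⟨v, trivial, by rw [hlab.f_one_eq, hv]; omega⟩

end IsStrongLabeling

end Quadrangulation

theorem NonCrossing.const_sub {V : Type*} {H : SimpleGraph V} {x y : V → ℤ}
    (h : NonCrossing H x) {k : ℤ} (hy : ∀ v, y v = k - x v) : NonCrossing H y := by
  intro a b c d hab hbc hcd hadj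
  rw [hy, hy] at hab hbc hcd
  exact h d c b a (by omega) (by omega) (by omega) ⟨hadj.2.symm, hadj.1.symm⟩

theorem Alternating.const_sub {V : Type*} {H : SimpleGraph V} {x y : V → ℤ}
    (h : Alternating H x) {k : ℤ} (hy : ∀ v, y v = k - x v) : Alternating H y := by
  intro a b c hab hbc hadj
  rw [hy, hy] at hab hbc
  exact h c b a (by omega) (by omega) ⟨hadj.2.symm, hadj.1.symm⟩

namespace Quadrangulation

variable {V : Type*} {Q : Quadrangulation V} {lab : Q.graph.Dart → Fin 2}

theorem tree_adj {i : Fin 2} {u v : V} : (Q.tree lab i).Adj u v ↔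
    ∃ d ∈ Q.T lab i, d.fst = u ∧ d.snd = v ∨ d.fst = v ∧ d.snd = u := by
  rw [tree, SimpleGraph.fromEdgeSet_adj, Set.mem_image]
  constructor
  · rintro ⟨⟨d, hd, h⟩, -⟩
    exact ⟨d, hd, Sym2.eq_iff.1 h⟩
  · rintro ⟨d, hd, h⟩
    refine ⟨⟨d, hd, Sym2.eq_iff.2 h⟩, ?_⟩
    rcases h with ⟨rfl, rfl⟩ | ⟨rfl, rfl⟩
    · exact d.adj.ne
    · exact d.adj.ne'

theorem adj_of_tree_adj {i : Fin 2} {u v : V} (h : (Q.tree lab i).Adj u v) :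
    Q.graph.Adj u v := by
  obtain ⟨d, -, ⟨rfl, rfl⟩ | ⟨rfl, rfl⟩⟩ := tree_adj.1 h
  · exact d.adj
  · exact d.adj.symm

namespace IsStrongLabeling

variable [Finite V] (hlab : Q.IsStrongLabeling lab)

include hlab

omit [Finite V] in
theorem not_tree_adj_s (i : Fin 2) (v : V) : ¬ (Q.tree lab i).Adj (Q.s (1 - i)) v := by
  rw [tree_adj]
  rintro ⟨d, hd, h | h⟩
  · exact hlab.fst_ne_s hd _ h.1
  · exact absurd (hlab.eq_of_snd_eq_s hd h.2) (by clear * -; revert i; decide)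

theorem induce_tree_isTree (i : Fin 2) :
    ((Q.tree lab i).induce {v | v ≠ Q.s (1 - i)}).IsTree := by
  have hii : i ≠ 1 - i := by revert i; decide
  have hsi : Q.s i ≠ Q.s (1 - i) := by
    rcases Fin.exists_fin_two.1 ⟨i, rfl⟩ with rfl | rfl
    · exact Q.s_ne
    · exact Q.s_ne.symm
  have hconn : ((Q.tree lab i).induce {v | v ≠ Q.s (1 - i)}).Connected := by
    rw [SimpleGraph.connected_iff_exists_forall_reachable]
    refine ⟨⟨Q.s i, hsi⟩, ?_⟩
    rintro ⟨v, hv⟩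
    have h : Relation.ReflTransGen _ v (Q.s i) := hlab.reaches_s hv
    induction h using Relation.ReflTransGen.head_induction_on with
    | refl => rfl
    | head hvb _ ih =>
      obtain ⟨d, hd, rfl, rfl⟩ := hvb
      have hs : d.snd ≠ Q.s (1 - i) := fun h => hii (hlab.eq_of_snd_eq_s hd h).symm
      refine (ih hs).trans (SimpleGraph.Adj.reachable ?_)
      rw [SimpleGraph.comap_adj]
      exact tree_adj.2 ⟨d, hd, Or.inr ⟨rfl, rfl⟩⟩
  rw [SimpleGraph.isTree_iff_connected_and_card]
  refine ⟨hconn, le_antisymm ?_ hconn.card_vert_le_card_edgeSet_add_one⟩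
  have hV : Nat.card {v | v ≠ Q.s (1 - i)} = Nat.card Q.Inner + 1 := by
    have h1 := Set.ncard_add_ncard_compl ({Q.s (1 - i)} : Set V)
    rw [Set.ncard_singleton, card_eq Q] at h1
    have h2 : ({Q.s (1 - i)} : Set V)ᶜ.ncard = Nat.card {v | v ≠ Q.s (1 - i)} := rfl
    omega
  rw [hV, Nat.add_le_add_iff_right]
  have hex : ∀ e : ((Q.tree lab i).induce {v | v ≠ Q.s (1 - i)}).edgeSet,
      ∃ v : Q.Inner, ∃ d ∈ Q.T lab i, d.fst = v ∧ e.1.map Subtype.val = d.edge := by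
    rintro ⟨e, he⟩
    induction e using Sym2.ind with
    | _ x y =>
      rw [SimpleGraph.mem_edgeSet, SimpleGraph.comap_adj] at he
      obtain ⟨d, hd, h⟩ := tree_adj.1 he
      exact ⟨⟨d.fst, hlab.fst_ne_s hd⟩, d, hd, rfl, (Sym2.eq_iff.2 h).symm⟩
  choose g d hd hg he using hex
  refine Nat.card_le_card_of_injective g fun a b hab => Subtype.ext ?_
  apply Sym2.map.injective Subtype.val_injective
  rw [he, he, hlab.T_unique (hd a) (hd b) (by rw [hg, hg, hab])]

theorem reaches_of_f_mem_Icc {i : Fin 2} {u v w a : V} (hu : Q.Reaches lab i u a)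
    (hv : Q.Reaches lab i v a) (huw : Q.f lab 0 u ≤ Q.f lab 0 w)
    (hwv : Q.f lab 0 w ≤ Q.f lab 0 v) : Q.Reaches lab i w a := by
  have h0 := (f_s_zero Q lab).1
  have h1 := (f_s_one Q lab).1
  have hinj := hlab.f_zero_injective
  have hend : ∀ j, Q.Reaches lab i u (Q.s j) → Q.Reaches lab i v (Q.s j) →
      Q.Reaches lab i w (Q.s j) := by
    intro j hu hv
    by_cases hj : j = i
    · subst hj
      refine hlab.reaches_s fun hw => ?_
      have key : ¬ Q.Reaches lab j (Q.s (1 - j)) (Q.s j) := by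
        rw [hlab.reaches_s_iff]
        rcases Fin.exists_fin_two.1 ⟨j, rfl⟩ with rfl | rfl
        · exact Q.s_ne
        · exact Q.s_ne.symm
      subst hw
      rcases Fin.exists_fin_two.1 ⟨j, rfl⟩ with rfl | rfl
      · have := (hlab.f_zero_mem_Icc v).2
        rw [sub_zero] at *
        rw [hinj (a₁ := v) (a₂ := Q.s 1) (by omega)] at hv
        exact key hv
      · have := (hlab.f_zero_mem_Icc u).1
        rw [sub_self] at *
        rw [hinj (a₁ := u) (a₂ := Q.s 0) (by omega)] at hu
        exact key hu
    · rw [← ne_eq, Fin.ne_iff_eq_one_sub] at hj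
      subst hj
      rw [hlab.eq_of_reaches_s hu] at huw
      rw [hlab.eq_of_reaches_s hv] at hwv
      rw [hinj (le_antisymm hwv huw)]
      exact Reaches.refl _
  rcases eq_s_or_inner Q a with rfl | rfl | ⟨a, rfl⟩
  · exact hend 0 hu hv
  · exact hend 1 hu hv
  · have hs : ∀ j, ¬ Q.Reaches lab i (Q.s j) a := fun j h => a.2 j (hlab.reaches_s_iff.1 h)
    rcases eq_s_or_inner Q u with rfl | rfl | ⟨u, rfl⟩
    · exact absurd hu (hs 0)
    · exact absurd hu (hs 1)
    rcases eq_s_or_inner Q v with rfl | rfl | ⟨v, rfl⟩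
    · exact absurd hv (hs 0)
    · exact absurd hv (hs 1)
    have hbu := hlab.f_zero_bounds u
    have hbv := hlab.f_zero_bounds v
    rcases eq_s_or_inner Q w with rfl | rfl | ⟨w, rfl⟩
    · omega
    · omega
    simp only [hlab.f_zero_coe, Nat.cast_le] at huw hwv
    exact hlab.reaches_of_index_mem_Icc hu hv huw hwv

theorem f_le_of_reaches {i : Fin 2} {v a : V} (h : Q.Reaches lab i v a)
    (ha : a ∈ Q.black ↔ i = 0) : Q.f lab 0 a ≤ Q.f lab 0 v := by
  have h0 := (f_s_zero Q lab).1
  rcases eq_s_or_inner Q a with rfl | rfl | ⟨a, rfl⟩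
  · rw [h0]
    exact (hlab.f_zero_mem_Icc v).1
  · obtain rfl := ha.1 (Q.s_black 1)
    rw [hlab.eq_of_reaches_s (v := v) (i := 0) h, sub_zero]
  · rcases eq_s_or_inner Q v with rfl | rfl | ⟨v, rfl⟩
    · rw [hlab.reaches_s_iff.1 h]
    · rw [hlab.reaches_s_iff.1 h]
    · rw [hlab.f_zero_coe, hlab.f_zero_coe, Nat.cast_le]
      exact hlab.index_le_of_reaches h ha

theorem le_f_of_reaches {i : Fin 2} {v a : V} (h : Q.Reaches lab i v a)
    (ha : ¬ (a ∈ Q.black ↔ i = 0)) : Q.f lab 0 v ≤ Q.f lab 0 a := by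
  have h1 := (f_s_one Q lab).1
  rcases eq_s_or_inner Q a with rfl | rfl | ⟨a, rfl⟩
  · have hi : i = 1 := by
      rcases Fin.exists_fin_two.1 ⟨i, rfl⟩ with rfl | rfl
      · exact absurd (iff_of_true (Q.s_black 0) rfl) ha
      · rfl
    subst hi
    rw [hlab.eq_of_reaches_s (v := v) (i := 1) h, sub_self]
  · rw [h1]
    exact (hlab.f_zero_mem_Icc v).2
  · rcases eq_s_or_inner Q v with rfl | rfl | ⟨v, rfl⟩
    · rw [hlab.reaches_s_iff.1 h]
    · rw [hlab.reaches_s_iff.1 h]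
    · rw [hlab.f_zero_coe, hlab.f_zero_coe, Nat.cast_le]
      exact hlab.le_index_of_reaches h ha

omit hlab [Finite V] in
theorem reaches_or_of_tree_adj {i : Fin 2} {u v : V} (h : (Q.tree lab i).Adj u v) :
    Q.Reaches lab i u v ∨ Q.Reaches lab i v u := by
  obtain ⟨d, hd, ⟨rfl, rfl⟩ | ⟨rfl, rfl⟩⟩ := tree_adj.1 h
  · exact Or.inl (Reaches.of_mem_T hd)
  · exact Or.inr (Reaches.of_mem_T hd)

theorem f_lt_of_tree_adj {i : Fin 2} {u v : V} (h : (Q.tree lab i).Adj u v)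
    (hu : u ∈ Q.black ↔ i = 0) : Q.f lab 0 u < Q.f lab 0 v := by
  have hv : ¬ (v ∈ Q.black ↔ i = 0) := by
    have := fst_mem_black_iff ⟨(u, v), adj_of_tree_adj h⟩
    change u ∈ Q.black ↔ v ∉ Q.black at this
    tauto
  refine lt_of_le_of_ne ?_ (hlab.f_zero_injective.ne h.ne)
  rcases reaches_or_of_tree_adj h with h | h
  · exact hlab.le_f_of_reaches h hv
  · exact hlab.f_le_of_reaches h hu

theorem black_iff_of_f_lt {i : Fin 2} {u v : V} (h : (Q.tree lab i).Adj u v)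
    (huv : Q.f lab 0 u < Q.f lab 0 v) :
    (u ∈ Q.black ↔ i = 0) ∧ ¬ (v ∈ Q.black ↔ i = 0) := by
  have hv : ¬ (v ∈ Q.black ↔ i = 0) := fun hv =>
    lt_asymm huv (hlab.f_lt_of_tree_adj h.symm hv)
  refine ⟨?_, hv⟩
  have := fst_mem_black_iff ⟨(u, v), adj_of_tree_adj h⟩
  change u ∈ Q.black ↔ v ∉ Q.black at this
  tauto

theorem alternating_tree (i : Fin 2) : Alternating (Q.tree lab i) (Q.f lab 0) :=
  fun _ _ _ hab hbc h => (hlab.black_iff_of_f_lt h.1 hab).2 (hlab.black_iff_of_f_lt h.2 hbc).1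

/-- A directed path that starts with an edge of `T i` from `u` to `v` reaches `w` through `v`. -/
theorem reaches_of_tree_adj {i : Fin 2} {u v w : V} (h : (Q.tree lab i).Adj u v)
    (hu : Q.Reaches lab i u w) (hne : u ≠ w) : Q.Reaches lab i v w := by
  obtain ⟨d, hd, ⟨rfl, rfl⟩ | ⟨rfl, rfl⟩⟩ := tree_adj.1 h
  · exact ((hlab.reaches_fst_iff hd).1 hu).resolve_left hne
  · exact (Reaches.of_mem_T hd).trans hu

theorem nonCrossing_tree (i : Fin 2) : NonCrossing (Q.tree lab i) (Q.f lab 0) := by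
  rintro p r q s hpr hrq hqs ⟨hpq, hrs⟩
  have hq := (hlab.black_iff_of_f_lt hpq (hpr.trans hrq)).2
  have hr := (hlab.black_iff_of_f_lt hrs (hrq.trans hqs)).1
  have hne : ∀ {u v}, Q.f lab 0 u < Q.f lab 0 v → u ≠ v := fun h h' => h.ne (congrArg _ h')
  rcases reaches_or_of_tree_adj hpq with h | h
  · have h1 := hlab.reaches_of_f_mem_Icc h (Reaches.refl q) hpr.le hrq.le
    have h2 := hlab.reaches_of_tree_adj hrs h1 (hne hrq)
    exact absurd (hlab.le_f_of_reaches h2 hq) (not_le.2 hqs)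
  · rcases reaches_or_of_tree_adj hrs with h' | h'
    · have h1 := hlab.reaches_of_f_mem_Icc (Reaches.refl p) h hpr.le hrq.le
      have h2 := hlab.reaches_of_tree_adj hrs h1 (hne hpr).symm
      have h3 := hlab.reaches_of_f_mem_Icc h' (Reaches.refl s) hrq.le hqs.le
      have h4 := hlab.reaches_of_tree_adj hpq.symm h3 (hne hqs)
      exact hne (hpr.trans (hrq.trans hqs)) (hlab.reaches_antisymm h4 h2)
    · have h3 := hlab.reaches_of_f_mem_Icc (Reaches.refl r) h' hrq.le hqs.le
      have h4 := hlab.reaches_of_tree_adj hpq.symm h3 (hne hrq).symm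
      exact absurd (hlab.f_le_of_reaches h4 hr) (not_le.2 hpr)

theorem isTwoBookEmbedding : IsTwoBookEmbedding Q.graph (Q.f lab 1) (Q.tree lab) where
  injective := Set.injOn_univ.1 (hlab.bijOn_f 1).injOn
  cover := by
    ext u v
    rw [SimpleGraph.sup_adj]
    refine ⟨fun h => h.elim adj_of_tree_adj adj_of_tree_adj, fun h => ?_⟩
    suffices ∃ i, (Q.tree lab i).Adj u v from Fin.exists_fin_two.1 this
    obtain ⟨i, hi | hi⟩ := hlab.mem_T_or_symm_mem_T ⟨(u, v), h⟩
    · exact ⟨i, tree_adj.2 ⟨_, hi, Or.inl ⟨rfl, rfl⟩⟩⟩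
    · exact ⟨i, tree_adj.2 ⟨_, hi, Or.inr ⟨rfl, rfl⟩⟩⟩
  disjoint := by
    rw [SimpleGraph.disjoint_left]
    intro u v h0 h1
    obtain ⟨d, hd, hd'⟩ := tree_adj.1 h0
    obtain ⟨e, he, he'⟩ := tree_adj.1 h1
    have hde : d.edge = e.edge := (Sym2.eq_iff.2 hd').trans (Sym2.eq_iff.2 he').symm
    rcases SimpleGraph.dart_edge_eq_iff d e |>.1 hde with rfl | rfl
    · exact zero_ne_one (hd.2.1.symm.trans he.2.1)
    · have := hlab.symm_mem_T_iff.1 hd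
      exact he.1 (this.1.trans this.2.symm)
  nonCrossing i := (hlab.nonCrossing_tree i).const_sub hlab.f_one_eq

end IsStrongLabeling

end Quadrangulation

theorem mainTheorem2 {V : Type*} [Finite V] (Q : Quadrangulation V)
    (lab : Q.graph.Dart → Fin 2) (hlab : Q.IsStrongLabeling lab) :
    -- the points `(f 0 v, f 1 v)` lie equally spaced on a line, in `Nat.card V` distinct places
    (∀ v, Q.f lab 0 v + Q.f lab 1 v = (Nat.card V : ℤ) - 3) ∧
    (∀ i, Set.BijOn (Q.f lab i) Set.univ (Set.Icc (-1) ((Nat.card V : ℤ) - 2))) ∧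
    -- `T i` is a tree, which spans all vertices but `s (1 - i)`
    (∀ i, (∀ v, ¬ (Q.tree lab i).Adj (Q.s (1 - i)) v) ∧
      ((Q.tree lab i).induce {v | v ≠ Q.s (1 - i)}).IsTree) ∧
    -- both trees are non-crossing and alternating
    (∀ i, NonCrossing (Q.tree lab i) (Q.f lab 1)) ∧
    (∀ i, Alternating (Q.tree lab i) (Q.f lab 1)) ∧
    -- this is a 2-book embedding of the quadrangulation, with one tree on each page
    IsTwoBookEmbedding Q.graph (Q.f lab 1) (Q.tree lab) :=
  ⟨hlab.f_add_f, hlab.bijOn_f, fun i => ⟨hlab.not_tree_adj_s i, hlab.induce_tree_isTree i⟩,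
    fun i => hlab.isTwoBookEmbedding.nonCrossing i,
    fun i => (hlab.alternating_tree i).const_sub hlab.f_one_eq, hlab.isTwoBookEmbedding⟩
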